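/- Let $B\subset\mathbb R^4$ be a bounded connected open set with smooth boundary, and let $E$ be a Hermitian vector bundle of finite rank over $\bar B$ with a unitary connection $A$, both smooth up to the boundary. Let the Clifford operators be anti-self-adjoint with $c_\mu c_\nu+c_\nu c_\mu=-2\delta_{\mu\nu}$, the half-spinor spaces $S_\pm$ being labelled so that anti-self-dual two-forms act as zero on $S_+$. For $z\in\hat{\mathbb R}^4$ put $A_z=A+2\pi i\sum_\mu z_\mu dx_\mu$ and $$\hat E_z=\ker D^-_{A_z}=\{s\in L^2(B,E\otimes S_-): D^-_{A_z}s=0 \text{ in the sense of distributions on } B\}.$$ Let $P_z$ be the orthogonal projection of $L^2(B,E\otimes S_-)$ onto the closed subspace $\hat E_z$, let $\hat A$ be the connection on $\hat E=\bigcup_z\hat E_z$ with covariant derivative $\hat\nabla_\mu=P_z\,\partial/\partial z_\mu$ on smooth sections (smooth maps $\psi:\hat{\mathbb R}^4\to L^2(B,E\otimes S_-)$ with $\psi(z)\in\hat E_z$), and let $\hat F_{\mu\nu}=\hat\nabla_\mu\hat\nabla_\nu-\hat\nabla_\nu\hat\nabla_\mu$ be its curvature. Let $H^2_D=\hat E_0=\ker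 D_A^-$ be the Bergmann space, and let $\hat x_\mu=P_0\circ x_\mu:H^2_D\to H^2_D$, where $x_\mu$ is multiplication by the $\mu$-th coordinate. A two-form $F$ is called ASD if $F_{12}+F_{34}=F_{13}+F_{42}=F_{14}+F_{23}=0$; a connection is ASD if its curvature is. 1. $\hat E$ is a smooth Hilbert subbundle of the trivial bundle with fibre $L^2(B,E\otimes S_-)$: the map $z\mapsto P_z$ is smooth in the operator norm. Moreover $\hat E_z=e^{-2\pi i\langle z,x\rangle}H^2_D$ for all $z$. For every smooth $\sigma:\hat{\mathbb R}^4\to H^2_D$ the map $z\mapsto e^{-2\pi i\langle z,x\rangle}\sigma(z)$ is a smooth section of $\hat E$, and $\hat\nabla_\mu\bigl(e^{-2\pi i\langle z,x\rangle}\sigma\bigr)=e^{-2\pi i\langle z,x\rangle}\bigl(\partial_\mu\sigma-2\pi i\,\hat x_\mu\sigma\bigr)$. 2. $\hat A$ is ASD if and only if $$[\hat x_1,\hat x_2]+[\hat x_3,\hat x_4]=0,\qquad [\hat x_1,\hat x_3]+[\hat x_4,\hat x_2]=0,\qquad [\hat x_1,\hat x_4]+[\hat x_2,\hat x_3]=0.$$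 3. If $A$ is ASD, then $\hat A$ is ASD, and the three equations in 2 hold. -/

import Mathlib

open MeasureTheory Set Matrix
open scoped ContDiff

noncomputable section

namespace LocalNahm

/-- Euclidean four-space; it is also used for the dual space with coordinates `z_μ`. -/
abbrev R4 : Type := EuclideanSpace ℝ (Fin 4)

/-- The partial derivative `∂_μ f` at `x`. -/
def pd {X : Type*} [NormedAddCommGroup X] [NormedSpace ℝ X] (μ : Fin 4) (f : R4 → X) (x : R4) : X :=
  fderiv ℝ f x (EuclideanSpace.single μ 1)

/-- The components `F μ ν` of a two-form on Euclidean four-space (coordinates are numbered from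
`0` to `3`) satisfy the anti-self-duality equations `*F = -F`. -/
def IsASDForm {X : Type*} [AddCommGroup X] (F : Fin 4 → Fin 4 → X) : Prop :=
  F 0 1 + F 2 3 = 0 ∧ F 0 2 + F 3 1 = 0 ∧ F 0 3 + F 1 2 = 0

/-- A bounded connected open set `B ⊆ ℝ⁴` with smooth boundary. -/
structure SmoothDomain where
  carrier : Set R4
  isOpen : IsOpen carrier
  isConnected : IsConnected carrier
  isBounded : Bornology.IsBounded carrier
  smooth_boundary : ∀ p ∈ frontier carrier, ∃ V : Set R4, IsOpen V ∧ p ∈ V ∧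
    ∃ ρ : R4 → ℝ, ContDiff ℝ ∞ ρ ∧ fderiv ℝ ρ p ≠ 0 ∧ carrier ∩ V = {x | ρ x < 0} ∩ V

/-- The standard fibre of a Hermitian vector bundle of rank `n`. -/
abbrev V (n : ℕ) : Type := EuclideanSpace ℂ (Fin n)

/-- The standard fibre of `E ⊗ S_±`, where `S_± = ℂ²`: two-component spinors with values in the
fibre of `E`, with the Hermitian inner product `⟨w, w'⟩ = ∑ a, ⟨w a, w' a⟩`. -/
abbrev W (n : ℕ) : Type := PiLp 2 (fun _ : Fin 2 => V n)

/-- The action of an endomorphism of the fibre of `E` on the fibre of `E ⊗ S_±`. -/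
def actE {n : ℕ} (T : V n →L[ℂ] V n) (w : W n) : W n := WithLp.toLp 2 fun a => T (w a)

/-- The action of a matrix on the spinor factor of `E ⊗ S_±`. -/
def actS {n : ℕ} (M : Matrix (Fin 2) (Fin 2) ℂ) (w : W n) : W n :=
  WithLp.toLp 2 fun a => ∑ b, M a b • w b

/-- Clifford multiplication `c_μ : S_- → S_+`. -/
def cliffMinus : Fin 4 → Matrix (Fin 2) (Fin 2) ℂ :=
  ![1, !![Complex.I, 0; 0, -Complex.I], !![0, 1; -1, 0], !![0, Complex.I; Complex.I, 0]]

/-- Clifford multiplication `c_μ : S_+ → S_-`; it is minus the adjoint of `c_μ : S_- → S_+`, so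
the operators `c_μ` on `S_+ ⊕ S_-` are anti-self-adjoint. -/
def cliffPlus (μ : Fin 4) : Matrix (Fin 2) (Fin 2) ℂ := -(cliffMinus μ)ᴴ

/-- The Clifford relations `c_μ c_ν + c_ν c_μ = -2 δ_{μν}` on `S_-`. -/
theorem cliff_relations_minus (μ ν : Fin 4) :
    cliffPlus μ * cliffMinus ν + cliffPlus ν * cliffMinus μ = if μ = ν then (-2 : ℂ) • 1 else 0 := by
  ext a b
  simp only [cliffPlus, Matrix.add_apply, Matrix.mul_apply, Fin.sum_univ_two, Matrix.neg_apply,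
    Matrix.conjTranspose_apply]
  fin_cases μ <;> fin_cases ν <;> fin_cases a <;> fin_cases b <;>
    simp [cliffMinus] <;> norm_num

/-- The Clifford relations `c_μ c_ν + c_ν c_μ = -2 δ_{μν}` on `S_+`. -/
theorem cliff_relations_plus (μ ν : Fin 4) :
    cliffMinus μ * cliffPlus ν + cliffMinus ν * cliffPlus μ = if μ = ν then (-2 : ℂ) • 1 else 0 := by
  ext a b
  simp only [cliffPlus, Matrix.add_apply, Matrix.mul_apply, Fin.sum_univ_two, Matrix.neg_apply,
    Matrix.conjTranspose_apply]
  fin_cases μ <;> fin_cases ν <;> fin_cases a <;> fin_cases b <;>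
    simp [cliffMinus] <;> norm_num

/-- The labelling of the half-spinors: anti-self-dual two-forms act trivially on `S_+`. -/
theorem cliff_asd_plus :
    cliffMinus 0 * cliffPlus 1 = cliffMinus 2 * cliffPlus 3 ∧
    cliffMinus 0 * cliffPlus 2 = cliffMinus 3 * cliffPlus 1 ∧
    cliffMinus 0 * cliffPlus 3 = cliffMinus 1 * cliffPlus 2 := by
  refine ⟨?_, ?_, ?_⟩ <;> ext a b <;> simp only [cliffPlus, Matrix.mul_apply, Fin.sum_univ_two,
    Matrix.neg_apply, Matrix.conjTranspose_apply] <;> fin_cases a <;> fin_cases b <;>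
    simp [cliffMinus]

/-- A smooth Hermitian vector bundle of rank `n` with a smooth unitary connection over the closure
of `B`, smooth up to the boundary, given by a countable family of unitary trivialisations (members
of the family may be empty): a section is a family of functions `s_i : U i → ℂⁿ` with
`s_i = g i j s_j` on overlaps, and `∇_μ s` is the section given by `∂_μ s_i + A i μ s_i`. -/
structure HermitianBundle (B : SmoothDomain) (n : ℕ) where
  /-- the trivialising open sets -/
  U : ℕ → Set R4
  isOpen_U : ∀ i, IsOpen (U i)
  cover : closure B.carrier ⊆ ⋃ i, U i
  /-- the transition functions -/
  g : ℕ → ℕ → R4 → (V n →L[ℂ] V n)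
  g_smooth : ∀ i j, ContDiffOn ℝ ∞ (g i j) (U i ∩ U j ∩ closure B.carrier)
  g_unitary : ∀ i j, ∀ x ∈ U i ∩ U j ∩ closure B.carrier, g i j x ∈ unitary (V n →L[ℂ] V n)
  g_cocycle : ∀ i j k, ∀ x ∈ U i ∩ U j ∩ U k ∩ closure B.carrier,
    g i j x * g j k x = g i k x
  /-- the components of the connection matrices -/
  A : ℕ → Fin 4 → R4 → (V n →L[ℂ] V n)
  A_smooth : ∀ i μ, ContDiffOn ℝ ∞ (A i μ) (U i ∩ closure B.carrier)
  A_skew : ∀ i μ, ∀ x ∈ U i ∩ closure B.carrier, A i μ x ∈ skewAdjoint (V n →L[ℂ] V n)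
  A_compat : ∀ i j μ, ∀ x ∈ U i ∩ U j ∩ B.carrier,
    pd μ (g i j) x + A i μ x * g i j x = g i j x * A j μ x

namespace HermitianBundle

variable {B : SmoothDomain} {n : ℕ} (E : HermitianBundle B n)

/-- The curvature `F_{μν} = ∂_μ A_ν - ∂_ν A_μ + [A_μ, A_ν]` in the trivialisation `i`. -/
def curvature (i : ℕ) (μ ν : Fin 4) (x : R4) : V n →L[ℂ] V n :=
  pd μ (E.A i ν) x - pd ν (E.A i μ) x + (E.A i μ x * E.A i ν x - E.A i ν x * E.A i μ x)

/-- The connection is anti-self-dual on `B` (hence, by continuity, on its closure). -/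
def IsASD : Prop :=
  ∀ i, ∀ x ∈ E.U i ∩ B.carrier, IsASDForm fun μ ν => E.curvature i μ ν x

/-- The Hilbert space `L²(B, E ⊗ S_-)`. A measurable section is recorded, at each point `x`, by
its components in the trivialisation with the smallest index among those defined at `x`; since the
trivialisations are unitary, the inner product is `∫_B ⟨s, s'⟩`. -/
abbrev L2 (_E : HermitianBundle B n) : Type := Lp (W n) 2 (volume.restrict B.carrier)

/-- The smallest index of a trivialisation defined at `x`. -/
def indexAt (x : R4) : ℕ := sInf {i | x ∈ E.U i}

/-- The components of a section of `E ⊗ S_-` in the trivialisation `i`. -/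
def comp (i : ℕ) (s : R4 → W n) (x : R4) : W n := actE (E.g i (E.indexAt x) x) (s x)

/-- Smooth compactly supported sections of `E ⊗ S_+` over `U i ∩ B`, as functions in the
trivialisation `i`. -/
def IsTest (i : ℕ) (φ : R4 → W n) : Prop :=
  ContDiff ℝ ∞ φ ∧ HasCompactSupport φ ∧ tsupport φ ⊆ E.U i ∩ B.carrier

/-- The covariant derivative of `A_z = A + 2πi ∑ z_μ dx_μ`, in the trivialisation `i`. -/
def covDeriv (i : ℕ) (z : R4) (μ : Fin 4) (φ : R4 → W n) (x : R4) : W n :=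
  pd μ φ x + actE (E.A i μ x) (φ x) + ((2 * Real.pi * z μ : ℝ) * Complex.I : ℂ) • φ x

/-- The coupled Dirac operator `D⁺_{A_z} = ∑ c_μ ∇_μ` on smooth sections of `E ⊗ S_+`, in the
trivialisation `i`. -/
def diracPlus (i : ℕ) (z : R4) (φ : R4 → W n) (x : R4) : W n :=
  ∑ μ, actS (cliffPlus μ) (E.covDeriv i z μ φ x)

/-- `D⁻_{A_z} s = 0` in the sense of distributions on `B`, where `D⁻_{A_z}` is the formal adjoint
of `D⁺_{A_z}`. -/
def IsDiracField (z : R4) (s : R4 → W n) : Prop :=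
  ∀ i φ, E.IsTest i φ →
    ∫ x in E.U i ∩ B.carrier, inner ℂ (E.diracPlus i z φ x) (E.comp i s x) = 0

/-! ### The Dirac fields form a closed subspace -/

theorem inner_actE (T : V n →L[ℂ] V n) (v w : W n) :
    inner ℂ v (actE T w) = inner ℂ (actE (star T) v) w := by
  simp [actE, PiLp.inner_apply, ContinuousLinearMap.star_eq_adjoint,
    ContinuousLinearMap.adjoint_inner_left]

theorem continuous_actE : Continuous fun p : (V n →L[ℂ] V n) × W n => actE p.1 p.2 := by
  unfold actE
  refine (PiLp.continuous_toLp 2 _).comp (continuous_pi fun a => ?_)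
  exact continuous_fst.clm_apply ((PiLp.continuous_apply 2 _ a).comp continuous_snd)

theorem continuous_actS (M : Matrix (Fin 2) (Fin 2) ℂ) :
    Continuous fun w : W n => actS M w := by
  unfold actS
  refine (PiLp.continuous_toLp 2 _).comp (continuous_pi fun a => ?_)
  exact continuous_finsetSum _ fun b _ =>
    by fun_prop

theorem norm_actE_of_unitary {T : V n →L[ℂ] V n} (hT : T ∈ unitary (V n →L[ℂ] V n)) (w : W n) :
    ‖actE T w‖ = ‖w‖ := by
  have h : inner ℂ (actE T w) (actE T w) = inner ℂ w w := by
    rw [inner_actE]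
    congr 1
    have h1 := (Unitary.mem_iff.1 hT).1
    ext a : 1
    change (star T * T) (w a) = w a
    rw [h1]; rfl
  rw [@norm_eq_sqrt_re_inner ℂ, @norm_eq_sqrt_re_inner ℂ, h]

theorem mem_U_indexAt {x : R4} (hx : x ∈ B.carrier) : x ∈ E.U (E.indexAt x) := by
  obtain ⟨i, hi⟩ := mem_iUnion.1 (E.cover (subset_closure hx))
  exact Nat.sInf_mem (s := {i | x ∈ E.U i}) ⟨i, hi⟩

theorem measurable_indexAt : Measurable E.indexAt := by
  classical
  have hm : ∀ i, MeasurableSet (E.U i) := fun i => (E.isOpen_U i).measurableSet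
  refine measurable_to_countable' fun k => ?_
  have : E.indexAt ⁻¹' {k} = (E.U k ∩ ⋂ j ∈ {j | j < k}, (E.U j)ᶜ) ∪
      (if k = 0 then ⋂ j, (E.U j)ᶜ else ∅) := by
    ext x
    simp only [mem_preimage, mem_singleton_iff, mem_union, mem_inter_iff, mem_iInter,
      mem_ofPred_eq, mem_compl_iff]
    constructor
    · rintro rfl
      by_cases h : ∃ i, x ∈ E.U i
      · exact Or.inl ⟨Nat.sInf_mem (s := {i | x ∈ E.U i}) h,
          fun j hj hx => Nat.notMem_of_lt_sInf (s := {i | x ∈ E.U i}) hj hx⟩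
      · right
        have h0 : E.indexAt x = 0 := by
          unfold indexAt
          rw [Nat.sInf_eq_zero]
          right
          exact eq_empty_of_forall_notMem fun i hi => h ⟨i, hi⟩
        rw [if_pos h0]
        exact mem_iInter.2 fun j hj => h ⟨j, hj⟩
    · rintro (⟨h1, h2⟩ | h)
      · exact le_antisymm (Nat.sInf_le h1)
          (le_csInf ⟨k, h1⟩ fun j hj => not_lt.1 fun hlt => h2 j hlt hj)
      · split_ifs at h with hk
        · subst hk
          unfold indexAt
          rw [Nat.sInf_eq_zero]
          right
          exact eq_empty_of_forall_notMem fun i hi => mem_iInter.1 h i hi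
        · exact h.elim
  rw [this]
  refine ((hm k).inter (MeasurableSet.biInter (to_countable _) fun j _ => (hm j).compl)).union ?_
  split_ifs
  · exact MeasurableSet.iInter fun j => (hm j).compl
  · exact MeasurableSet.empty

theorem diracPlus_continuousOn (i : ℕ) (z : R4) {φ : R4 → W n} (hφ : E.IsTest i φ) :
    ContinuousOn (E.diracPlus i z φ) (E.U i ∩ B.carrier) := by
  unfold diracPlus covDeriv
  refine continuousOn_finsetSum _ fun μ _ => ?_
  refine (continuous_actS _).comp_continuousOn ?_
  have hc : Continuous φ := hφ.1.continuous
  have h1 : Continuous (pd μ φ) := (hφ.1.continuous_fderiv (by simp)).clm_apply continuous_const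
  have h2 : ContinuousOn (E.A i μ) (E.U i ∩ B.carrier) :=
    (E.A_smooth i μ).continuousOn.mono (inter_subset_inter_right _ subset_closure)
  exact (h1.continuousOn.add (continuous_actE.comp_continuousOn (h2.prodMk hc.continuousOn))).add
    (by fun_prop)

theorem diracPlus_eq_zero (i : ℕ) (z : R4) {φ : R4 → W n} {x : R4} (hx : x ∉ tsupport φ) :
    E.diracPlus i z φ x = 0 := by
  have h0 : φ x = 0 := image_eq_zero_of_notMem_tsupport hx
  have h1 : fderiv ℝ φ x = 0 := image_eq_zero_of_notMem_tsupport
    fun h => hx (tsupport_fderiv_subset ℝ h)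
  have hS : ∀ M, actS M (0 : W n) = 0 := fun M => by ext a : 1; simp [actS]
  have hE : ∀ T, actE T (0 : W n) = 0 := fun T => by ext a : 1; simp [actE]
  simp [diracPlus, covDeriv, pd, h0, h1, hS, hE]

/-- `D⁺_{A_z} φ` as a section recorded in the way of `L2`. -/
def diracRep (i : ℕ) (z : R4) (φ : R4 → W n) : R4 → W n :=
  (E.U i ∩ B.carrier).indicator fun x => actE (star (E.g i (E.indexAt x) x)) (E.diracPlus i z φ x)

theorem memLp_diracRep (i : ℕ) (z : R4) {φ : R4 → W n} (hφ : E.IsTest i φ) :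
    MemLp (E.diracRep i z φ) 2 (volume.restrict B.carrier) := by
  have hUB : MeasurableSet (E.U i ∩ B.carrier) := ((E.isOpen_U i).inter B.isOpen).measurableSet
  have : IsFiniteMeasure ((volume : Measure R4).restrict B.carrier) :=
    ⟨by rw [Measure.restrict_apply_univ]; exact B.isBounded.measure_lt_top⟩
  have hcont := E.diracPlus_continuousOn i z hφ
  obtain ⟨C, hC⟩ := (hφ.2.1.isCompact).exists_bound_of_continuousOn (hcont.mono hφ.2.2)
  refine MemLp.of_bound (C := max C 0) ?_ (ae_of_all _ fun x => ?_)
  · unfold diracRep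
    rw [aestronglyMeasurable_indicator_iff hUB, Measure.restrict_restrict hUB]
    have hsub : (E.U i ∩ B.carrier) ∩ B.carrier =
        ⋃ k : ℕ, (E.U i ∩ B.carrier) ∩ (E.indexAt ⁻¹' {k}) := by
      ext x; simp only [mem_inter_iff, mem_iUnion, mem_preimage, mem_singleton_iff]
      exact ⟨fun h => ⟨_, h.1, rfl⟩, fun ⟨_, h, _⟩ => ⟨h, h.2⟩⟩
    rw [hsub, aestronglyMeasurable_iUnion_iff]
    intro k
    have hms : MeasurableSet ((E.U i ∩ B.carrier) ∩ (E.indexAt ⁻¹' {k})) :=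
      hUB.inter (E.measurable_indexAt (measurableSet_singleton k))
    have hg : ContinuousOn (E.g i k) ((E.U i ∩ B.carrier) ∩ (E.indexAt ⁻¹' {k})) :=
      (E.g_smooth i k).continuousOn.mono fun x hx =>
        ⟨⟨hx.1.1, by have := E.mem_U_indexAt hx.1.2; rwa [show E.indexAt x = k from hx.2] at this⟩,
          subset_closure hx.1.2⟩
    have hc : ContinuousOn (fun x => actE (star (E.g i k x)) (E.diracPlus i z φ x))
        ((E.U i ∩ B.carrier) ∩ (E.indexAt ⁻¹' {k})) :=
      continuous_actE.comp_continuousOn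
        (((ContinuousLinearMap.adjoint (𝕜 := ℂ) (E := V n) (F := V n)).continuous.comp_continuousOn
          hg).prodMk (hcont.mono inter_subset_left))
    refine (hc.aestronglyMeasurable hms).congr ?_
    filter_upwards [ae_restrict_mem hms] with x hx
    rw [show E.indexAt x = k from hx.2]
  · by_cases hx : x ∈ E.U i ∩ B.carrier
    · rw [diracRep, indicator_of_mem hx, norm_actE_of_unitary
        (Unitary.star_mem (E.g_unitary _ _ x
          ⟨⟨hx.1, E.mem_U_indexAt hx.2⟩, subset_closure hx.2⟩))]
      by_cases hs : x ∈ tsupport φ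
      · exact (hC x hs).trans (le_max_left _ _)
      · rw [E.diracPlus_eq_zero i z hs]; simp
    · rw [diracRep, indicator_of_notMem hx]; simp

theorem integral_eq_inner (i : ℕ) (z : R4) {φ : R4 → W n} (hφ : E.IsTest i φ) (s : E.L2) :
    ∫ x in E.U i ∩ B.carrier, inner ℂ (E.diracPlus i z φ x) (E.comp i s x) =
      inner ℂ ((E.memLp_diracRep i z hφ).toLp) s := by
  have hUB : MeasurableSet (E.U i ∩ B.carrier) := ((E.isOpen_U i).inter B.isOpen).measurableSet
  have h1 : inner ℂ ((E.memLp_diracRep i z hφ).toLp) s =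
      ∫ x in B.carrier, (E.U i ∩ B.carrier).indicator
        (fun x => inner ℂ (E.diracPlus i z φ x) (E.comp i s x)) x := by
    rw [L2.inner_def]
    refine integral_congr_ae ?_
    filter_upwards [(E.memLp_diracRep i z hφ).coeFn_toLp] with x hx
    rw [hx, diracRep]
    by_cases h : x ∈ E.U i ∩ B.carrier
    · rw [indicator_of_mem h, indicator_of_mem h, comp, inner_actE]
    · rw [indicator_of_notMem h, indicator_of_notMem h, inner_zero_left]
  rw [h1, integral_indicator hUB, Measure.restrict_restrict hUB, inter_assoc, inter_self]

/-- The fibre `Ê_z = ker D⁻_{A_z}` inside `L²(B, E ⊗ S_-)`. -/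
def nahmFibre (z : R4) : Submodule ℂ E.L2 where
  carrier := {s | E.IsDiracField z s}
  zero_mem' := fun i φ hφ => by rw [E.integral_eq_inner i z hφ, inner_zero_right]
  add_mem' := fun {s t} hs ht i φ hφ => by
    have h1 := hs i φ hφ
    have h2 := ht i φ hφ
    rw [E.integral_eq_inner i z hφ] at h1 h2 ⊢
    rw [inner_add_right, h1, h2, add_zero]
  smul_mem' := fun c s hs i φ hφ => by
    have h1 := hs i φ hφ
    rw [E.integral_eq_inner i z hφ] at h1 ⊢
    rw [inner_smul_right, h1, mul_zero]

theorem isClosed_nahmFibre (z : R4) : IsClosed (E.nahmFibre z : Set E.L2) := by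
  have : (E.nahmFibre z : Set E.L2) = ⋂ (i : ℕ) (φ : R4 → W n) (h : E.IsTest i φ),
      {s : E.L2 | inner ℂ ((E.memLp_diracRep i z h).toLp) s = 0} := by
    ext s
    simp only [mem_iInter, mem_ofPred_eq]
    exact forall_congr' fun i => forall_congr' fun φ => forall_congr' fun h => by
      rw [E.integral_eq_inner i z h]
  rw [this]
  exact isClosed_iInter fun i => isClosed_iInter fun φ => isClosed_iInter fun h =>
    isClosed_eq (continuous_const.inner continuous_id) continuous_const

instance instCompleteSpaceNahmFibre (z : R4) : CompleteSpace (E.nahmFibre z) :=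
  (E.isClosed_nahmFibre z).completeSpace_coe

/-! ### The local Nahm transform -/

/-- The orthogonal projection `P_z` of `L²(B, E ⊗ S_-)` onto `Ê_z`. -/
def proj (z : R4) : E.L2 →L[ℂ] E.L2 := (E.nahmFibre z).starProjection

/-- A smooth section of `Ê`, viewed as a subbundle of the trivial Hilbert bundle over the dual
space with fibre `L²(B, E ⊗ S_-)`. -/
def IsSmoothSection (ψ : R4 → E.L2) : Prop := ContDiff ℝ ∞ ψ ∧ ∀ z, ψ z ∈ E.nahmFibre z

/-- The connection of `Ê`: the covariant derivative `P_z ∂/∂z_μ`. -/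
def nahmConn (μ : Fin 4) (ψ : R4 → E.L2) (z : R4) : E.L2 := E.proj z (pd μ ψ z)

/-- The curvature of `Ê` applied to a section. -/
def nahmCurvature (μ ν : Fin 4) (ψ : R4 → E.L2) (z : R4) : E.L2 :=
  E.nahmConn μ (E.nahmConn ν ψ) z - E.nahmConn ν (E.nahmConn μ ψ) z

/-- The local Nahm transform `(Ê, Â)` is anti-self-dual. -/
def NahmIsASD : Prop :=
  ∀ ψ, E.IsSmoothSection ψ → ∀ z, IsASDForm fun μ ν => E.nahmCurvature μ ν ψ z

/-! ### The operators on the Bergmann space -/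

/-- The Bergmann space `H²_D = Ê_0 = ker D⁻_A` (note that `A_0 = A`). -/
abbrev bergmann : Submodule ℂ E.L2 := E.nahmFibre 0

theorem memLp_top_of_continuous (f : C(R4, ℂ)) :
    MemLp f ⊤ (volume.restrict B.carrier) := by
  obtain ⟨C, hC⟩ := (B.isBounded.isCompact_closure).exists_bound_of_continuousOn
    f.continuous.continuousOn
  refine memLp_top_of_bound f.continuous.aestronglyMeasurable C ?_
  filter_upwards [ae_restrict_mem B.isOpen.measurableSet] with x hx
  exact hC x (subset_closure hx)

/-- Multiplication by a continuous function, as a bounded operator on `L²(B, E ⊗ S_-)`. -/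
def mulOp (f : C(R4, ℂ)) : E.L2 →L[ℂ] E.L2 :=
  (ContinuousLinearMap.lsmul ℂ ℂ).holderL (volume.restrict B.carrier) ⊤ 2 2
    (memLp_top_of_continuous f).toLp

/-- Multiplication by a continuous function acts pointwise. -/
theorem mulOp_apply_ae (f : C(R4, ℂ)) (s : E.L2) :
    E.mulOp f s =ᵐ[volume.restrict B.carrier] fun x => f x • s x := by
  have h := (ContinuousLinearMap.lsmul ℂ ℂ).coeFn_holder (r := 2)
    (memLp_top_of_continuous (B := B) f).toLp s
  filter_upwards [h, (memLp_top_of_continuous (B := B) f).coeFn_toLp] with x h1 h2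
  change (ContinuousLinearMap.holder 2 _ _ _) x = _
  rw [h1, h2]
  rfl

/-- The coordinate function `x_μ`. -/
def coord (μ : Fin 4) : C(R4, ℂ) := ⟨fun x => (x μ : ℂ), by fun_prop⟩

/-- The function `x ↦ exp(-2πi ⟨z, x⟩)`. -/
def phase (z : R4) : C(R4, ℂ) :=
  ⟨fun x => Complex.exp (-(2 * Real.pi * Complex.I) * ∑ μ, (z μ : ℂ) * (x μ : ℂ)), by fun_prop⟩

/-- The operator `x̂_μ = P_0 ∘ x_μ` on the Bergmann space. -/
def xhat (μ : Fin 4) : E.bergmann →L[ℂ] E.bergmann :=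
  E.bergmann.orthogonalProjectionOnto ∘L E.mulOp (coord μ) ∘L E.bergmann.subtypeL

/-- The commutator equations of ADHM type
`[x̂₁, x̂₂] + [x̂₃, x̂₄] = 0`, `[x̂₁, x̂₃] + [x̂₄, x̂₂] = 0`, `[x̂₁, x̂₄] + [x̂₂, x̂₃] = 0`. -/
def ADHMEquations : Prop :=
  IsASDForm fun μ ν => E.xhat μ * E.xhat ν - E.xhat ν * E.xhat μ

end HermitianBundle

end LocalNahm

end

noncomputable section

namespace LocalNahm

namespace HermitianBundle

variable {B : SmoothDomain} {n : ℕ} (E : HermitianBundle B n)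

/-! ### Multiplication operators -/

/-! Let `U_z` be multiplication by `e^{-2πi⟨z,x⟩}`. It is unitary on `L²`, and since `B` is bounded
it is the exponential of a bounded operator depending linearly on `z`, hence smooth in operator
norm. Multiplication of test functions by phases turns `A` into `A_z`, so `Ê_z = U_z H²_D` and `P_z
= U_z P_0 U_z⁻¹` (`nahmFibre_eq_map`, `proj_apply`). In the resulting global trivialisation the
covariant derivative is `∂_μ - 2πi x̂_μ` with constant coefficients, and its curvature is `(2πi)²
[x̂_μ, x̂_ν]`. Testing on constant functions gives the equivalence of anti-self-duality with the
commutator equations.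

Now let `A` be ASD and write `P = P_0`. For `s, t` in the Bergmann space, `⟨t, x̂_μ x̂_ν s⟩ = ⟨x_μ
t, x_ν s⟩ - ⟨(1-P) x_μ t, (1-P) x_ν s⟩` (`inner_xhat_xhat`). The first term is symmetric in `μ, ν`,
so only the second contributes to commutators.

The curvature of an ASD connection acts as zero on `S_+`, so `‖D⁺Φ‖² = ∑ ‖∇_μ Φ‖²` on compactly
supported sections (`inner_dirac_dirac`), and a Poincaré inequality bounds `‖Φ‖` by `‖D⁺Φ‖`. Hence
`D⁺` has a bounded left inverse `K` that vanishes on `(range D⁺)ᗮ`, which is the Bergmann space. The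
vector `(1-P) x_ν s` is orthogonal to that space and solves `D⁻ r = c_ν s` weakly, which forces
`(1-P) x_ν s = K* c_ν s`.

The gradient form on the right of the Weitzenböck identity does not see the spinor index, so `G = K
K*` commutes with Clifford multiplication (`green_comm`). The second term therefore equals `⟨t, c_μ*
c_ν G s⟩`, and the combinations of `c_μ* c_ν - c_ν* c_μ` in the three equations vanish on `S_-`,
because self-dual forms act there as zero. -/

theorem mulOp_mulOp (f g : C(R4, ℂ)) (s : E.L2) : E.mulOp f (E.mulOp g s) = E.mulOp (f * g) s := by
  refine Lp.ext ?_
  filter_upwards [E.mulOp_apply_ae f (E.mulOp g s), E.mulOp_apply_ae g s,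
    E.mulOp_apply_ae (f * g) s] with x h1 h2 h3
  rw [h1, h2, h3, ContinuousMap.mul_apply, mul_smul]

theorem mulOp_one (s : E.L2) : E.mulOp 1 s = s := by
  refine Lp.ext ?_
  filter_upwards [E.mulOp_apply_ae 1 s] with x h
  rw [h, ContinuousMap.one_apply, one_smul]

theorem inner_mulOp_left (f : C(R4, ℂ)) (s t : E.L2) :
    inner ℂ (E.mulOp f s) t = inner ℂ s (E.mulOp (star f) t) := by
  rw [L2.inner_def, L2.inner_def]
  refine integral_congr_ae ?_
  filter_upwards [E.mulOp_apply_ae f s, E.mulOp_apply_ae (star f) t] with x h1 h2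
  rw [h1, h2, inner_smul_left, inner_smul_right]
  rfl

theorem star_coord (μ : Fin 4) : star (coord μ) = coord μ := by
  ext x
  simp [coord]

theorem inner_mulOp_coord (μ : Fin 4) (s t : E.L2) :
    inner ℂ (E.mulOp (coord μ) s) t = inner ℂ s (E.mulOp (coord μ) t) := by
  rw [inner_mulOp_left, star_coord]

theorem mulOp_coord_comm (μ ν : Fin 4) (s : E.L2) :
    E.mulOp (coord μ) (E.mulOp (coord ν) s) = E.mulOp (coord ν) (E.mulOp (coord μ) s) := by
  rw [mulOp_mulOp, mulOp_mulOp, mul_comm]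

/-! ### The unitary group of phases and its generators. -/

theorem phase_zero : phase 0 = 1 := by
  ext x
  simp [phase]

theorem phase_add (z w : R4) : phase (z + w) = phase z * phase w := by
  ext x
  simp only [phase, ContinuousMap.coe_mk, ContinuousMap.mul_apply, ← Complex.exp_add, ← mul_add,
    ← Finset.sum_add_distrib]
  simp [add_mul]

theorem star_phase (z : R4) : star (phase z) = phase (-z) := by
  ext x
  simp only [phase, ContinuousMap.coe_mk, ContinuousMap.star_apply, RCLike.star_def,
    ← Complex.exp_conj]
  simp [Complex.conj_ofNat]

theorem mulOp_phase_add (z w : R4) (s : E.L2) :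
    E.mulOp (phase (z + w)) s = E.mulOp (phase z) (E.mulOp (phase w) s) := by
  rw [mulOp_mulOp, phase_add]

theorem mulOp_phase_neg (z : R4) (s : E.L2) :
    E.mulOp (phase z) (E.mulOp (phase (-z)) s) = s := by
  rw [← mulOp_phase_add, add_neg_cancel, phase_zero, mulOp_one]

theorem mulOp_neg_phase (z : R4) (s : E.L2) :
    E.mulOp (phase (-z)) (E.mulOp (phase z) s) = s := by
  rw [← mulOp_phase_add, neg_add_cancel, phase_zero, mulOp_one]

theorem inner_mulOp_phase (z : R4) (s t : E.L2) :
    inner ℂ (E.mulOp (phase z) s) t = inner ℂ s (E.mulOp (phase (-z)) t) := by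
  rw [inner_mulOp_left, star_phase]

/-- The generator `-2πi ∑ z_μ x_μ` of the phases, linear in `z`. -/
def phaseGen : R4 →L[ℝ] (E.L2 →L[ℂ] E.L2) :=
  ∑ μ, (EuclideanSpace.proj (𝕜 := ℝ) μ).smulRight
    (-(2 * Real.pi * Complex.I : ℂ) • E.mulOp (coord μ))

theorem phaseGen_apply (z : R4) :
    E.phaseGen z = ∑ μ, z μ • (-(2 * Real.pi * Complex.I : ℂ) • E.mulOp (coord μ)) := by
  simp [phaseGen]

theorem phaseGen_apply_ae (z : R4) (s : E.L2) :
    E.phaseGen z s =ᵐ[volume.restrict B.carrier]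
      fun x => (-(2 * Real.pi * Complex.I) * ∑ μ, (z μ : ℂ) * (x μ : ℂ) : ℂ) • s x := by
  have key : E.phaseGen z s = ∑ μ, (z μ * -(2 * Real.pi * Complex.I : ℂ)) • E.mulOp (coord μ) s := by
    rw [phaseGen_apply, _root_.sum_apply]
    refine Finset.sum_congr rfl fun μ _ => ?_
    rw [mul_smul]
    rfl
  rw [key]
  have h : ∀ᵐ x ∂(volume.restrict B.carrier), ∀ μ : Fin 4,
      ((z μ * -(2 * Real.pi * Complex.I : ℂ)) • E.mulOp (coord μ) s : E.L2) x =
        ((z μ * -(2 * Real.pi * Complex.I : ℂ)) * (x μ : ℂ)) • s x := by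
    rw [ae_all_iff]
    intro μ
    filter_upwards [Lp.coeFn_smul (z μ * -(2 * Real.pi * Complex.I : ℂ)) (E.mulOp (coord μ) s),
      E.mulOp_apply_ae (coord μ) s] with x h1 h2
    rw [h1, Pi.smul_apply, h2, smul_smul]
    rfl
  filter_upwards [h, Lp.coeFn_finsetSum Finset.univ
    (fun μ => (z μ * -(2 * Real.pi * Complex.I : ℂ)) • E.mulOp (coord μ) s)] with x h1 h2
  rw [h2, Finset.sum_apply]
  simp only [h1]
  rw [← Finset.sum_smul, Finset.mul_sum]
  congr 1
  exact Finset.sum_congr rfl fun μ _ => by ring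

/-- If an operator on `L²` acts as multiplication by a function, then its exponential acts as
multiplication by the exponential of the function. -/
theorem exp_apply_ae (Y : E.L2 →L[ℂ] E.L2) (f : R4 → ℂ)
    (hY : ∀ s : E.L2, Y s =ᵐ[volume.restrict B.carrier] fun x => f x • s x) (s : E.L2) :
    NormedSpace.exp Y s =ᵐ[volume.restrict B.carrier] fun x => Complex.exp (f x) • s x := by
  have hpow : ∀ k : ℕ, (Y ^ k) s =ᵐ[volume.restrict B.carrier] fun x => f x ^ k • s x := by
    intro k
    induction k with
    | zero => exact Filter.Eventually.of_forall fun x => by simp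
    | succ k ih =>
      rw [pow_succ']
      filter_upwards [hY ((Y ^ k) s), ih] with x h1 h2
      rw [mul_apply_eq_comp, h1, h2, smul_smul, pow_succ']
  let S : ℕ → E.L2 := fun N => ∑ k ∈ Finset.range N, ((k.factorial : ℂ)⁻¹ • (Y ^ k) s : E.L2)
  have hS : Filter.Tendsto S Filter.atTop (nhds (NormedSpace.exp Y s)) := by
    have h1 := (NormedSpace.exp_series_hasSum_exp' (𝕂 := ℂ) Y).tendsto_sum_nat
    have h2 := ((ContinuousLinearMap.apply ℂ E.L2 s).continuous.tendsto _).comp h1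
    refine h2.congr fun N => ?_
    simp [S]
  have hSx : ∀ᵐ x ∂(volume.restrict B.carrier), ∀ N, S N x =
      (∑ k ∈ Finset.range N, f x ^ k / (k.factorial : ℂ)) • s x := by
    rw [ae_all_iff]
    intro N
    have h3 : ∀ᵐ x ∂(volume.restrict B.carrier), ∀ k : ℕ,
        ((k.factorial : ℂ)⁻¹ • (Y ^ k) s : E.L2) x = (f x ^ k / (k.factorial : ℂ)) • s x := by
      rw [ae_all_iff]
      intro k
      filter_upwards [Lp.coeFn_smul (k.factorial : ℂ)⁻¹ ((Y ^ k) s), hpow k] with x h1 h2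
      rw [h1, Pi.smul_apply, h2, smul_smul, div_eq_inv_mul]
    filter_upwards [h3, Lp.coeFn_finsetSum (Finset.range N)
      (fun k : ℕ => ((k.factorial : ℂ)⁻¹ • (Y ^ k) s : E.L2))] with x h1 h2
    rw [h2, Finset.sum_apply, Finset.sum_smul]
    exact Finset.sum_congr rfl fun k _ => h1 k
  -- Convergence in `L²` gives pointwise convergence almost everywhere along a subsequence. This
  -- suffices, because the pointwise limit of the whole scalar series is already known.
  obtain ⟨ns, hns, hlim⟩ := (tendstoInMeasure_of_tendsto_Lp hS).exists_seq_tendsto_ae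
  filter_upwards [hSx, hlim] with x h1 h2
  refine tendsto_nhds_unique h2 ?_
  simp only [h1]
  refine Filter.Tendsto.smul_const ?_ _
  have h4 := (NormedSpace.expSeries_div_hasSum_exp (f x)).tendsto_sum_nat
  rw [← Complex.exp_eq_exp_ℂ] at h4
  exact h4.comp hns.tendsto_atTop

theorem mulOp_phase_eq_exp (z : R4) : E.mulOp (phase z) = NormedSpace.exp (E.phaseGen z) := by
  ext1 s
  refine Lp.ext ?_
  filter_upwards [E.mulOp_apply_ae (phase z) s,
    E.exp_apply_ae (E.phaseGen z) _ (E.phaseGen_apply_ae z) s] with x h1 h2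
  rw [h1, h2]
  rfl

theorem contDiff_mulOp_phase : ContDiff ℝ ∞ fun z => E.mulOp (phase z) := by
  have h : ContDiff ℝ ∞ (NormedSpace.exp : (E.L2 →L[ℂ] E.L2) → (E.L2 →L[ℂ] E.L2)) :=
    contDiff_iff_contDiffAt.2 fun Y => (NormedSpace.exp_analytic (𝕂 := ℝ) Y).contDiffAt
  have h2 := h.comp E.phaseGen.contDiff
  convert h2 using 1
  funext z
  exact E.mulOp_phase_eq_exp z

/-- Along a coordinate line the phases are a fixed operator times a one-parameter group `exp (t X)`,
so only the derivative of such a group is needed, not the full derivative of the exponential. -/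
theorem hasDerivAt_mulOp_phase_line (z : R4) (μ : Fin 4) :
    HasDerivAt (fun t : ℝ => E.mulOp (phase (z + t • EuclideanSpace.single μ (1 : ℝ))))
      (E.mulOp (phase z) * (-(2 * Real.pi * Complex.I : ℂ) • E.mulOp (coord μ))) 0 := by
  have h1 := hasDerivAt_exp_smul_const (𝕂 := ℝ)
    (-(2 * Real.pi * Complex.I : ℂ) • E.mulOp (coord μ)) (0 : ℝ)
  have h0 : NormedSpace.exp ((0 : ℝ) • (-(2 * Real.pi * Complex.I : ℂ) • E.mulOp (coord μ))) *
      (-(2 * Real.pi * Complex.I : ℂ) • E.mulOp (coord μ)) =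
        -(2 * Real.pi * Complex.I : ℂ) • E.mulOp (coord μ) := by
    rw [zero_smul, NormedSpace.exp_zero, one_mul]
  have h2 := (h1.congr_deriv h0).const_mul (E.mulOp (phase z))
  refine h2.congr_of_eventuallyEq (Filter.Eventually.of_forall fun t => ?_)
  have h3 : E.phaseGen (t • EuclideanSpace.single μ (1 : ℝ)) =
      t • (-(2 * Real.pi * Complex.I : ℂ) • E.mulOp (coord μ)) := by
    rw [map_smul, phaseGen_apply, Finset.sum_eq_single μ]
    · simp
    · intro ν _ h
      simp [h]
    · simp
  calc E.mulOp (phase (z + t • EuclideanSpace.single μ (1 : ℝ)))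
      = E.mulOp (phase z) * E.mulOp (phase (t • EuclideanSpace.single μ (1 : ℝ))) := by
        ext1 s
        exact E.mulOp_phase_add _ _ s
    _ = E.mulOp (phase z) *
          NormedSpace.exp (E.phaseGen (t • EuclideanSpace.single μ (1 : ℝ))) := by
        rw [mulOp_phase_eq_exp E (t • _)]
    _ = _ := by
        rw [h3]
        rfl

theorem pd_mulOp_phase (μ : Fin 4) (z : R4) :
    pd μ (fun z => E.mulOp (phase z)) z =
      E.mulOp (phase z) * (-(2 * Real.pi * Complex.I : ℂ) • E.mulOp (coord μ)) := by
  have hd : DifferentiableAt ℝ (fun z => E.mulOp (phase z)) z :=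
    E.contDiff_mulOp_phase.differentiable (by simp) z
  rw [← (E.hasDerivAt_mulOp_phase_line z μ).deriv]
  exact (hd.lineDeriv_eq_fderiv).symm

theorem pd_mulOp_phase_apply {τ : R4 → E.L2} (hτ : Differentiable ℝ τ) (μ : Fin 4) (z : R4) :
    pd μ (fun z => E.mulOp (phase z) (τ z)) z = E.mulOp (phase z)
      (pd μ τ z - (2 * Real.pi * Complex.I : ℂ) • E.mulOp (coord μ) (τ z)) := by
  have hd : DifferentiableAt ℝ (fun z => E.mulOp (phase z)) z :=
    E.contDiff_mulOp_phase.differentiable (by simp) z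
  -- The product rule is over `ℝ`, so the complex-linear operators are first regarded as real-linear
  -- ones.
  let R : (E.L2 →L[ℂ] E.L2) →L[ℝ] (E.L2 →L[ℝ] E.L2) :=
    ContinuousLinearMap.restrictScalarsL ℂ E.L2 E.L2 ℝ ℝ
  have h1 : HasFDerivAt (fun z => R (E.mulOp (phase z)))
      (R ∘L fderiv ℝ (fun z => E.mulOp (phase z)) z) z :=
    R.hasFDerivAt.comp z hd.hasFDerivAt
  have h2 := h1.clm_apply (hτ z).hasFDerivAt
  have h3 : fderiv ℝ (fun z => E.mulOp (phase z) (τ z)) z = _ := h2.fderiv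
  rw [pd, h3]
  have h4 := E.pd_mulOp_phase μ z
  have h5 : E.mulOp (phase z) (fderiv ℝ τ z (EuclideanSpace.single μ 1)) +
      (fderiv ℝ (fun z => E.mulOp (phase z)) z (EuclideanSpace.single μ 1)) (τ z) =
      E.mulOp (phase z)
      (pd μ τ z - (2 * Real.pi * Complex.I : ℂ) • E.mulOp (coord μ) (τ z)) := by
    rw [pd] at h4
    rw [h4, map_sub, sub_eq_add_neg, ← map_neg, pd, mul_apply_eq_comp,
      _root_.smul_apply, neg_smul]
  exact h5

end HermitianBundle

end LocalNahm

namespace LocalNahm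

/-! ### Calculus of the partial derivatives `pd`. -/

theorem pd_comm {X : Type*} [NormedAddCommGroup X] [NormedSpace ℝ X] {f : R4 → X} {x : R4}
    (hf : ContDiffAt ℝ ∞ f x) (μ ν : Fin 4) : pd μ (pd ν f) x = pd ν (pd μ f) x := by
  have hs : IsSymmSndFDerivAt ℝ f x := hf.isSymmSndFDerivAt (by
    rw [minSmoothness_of_isRCLikeNormedField]
    exact WithTop.coe_le_coe.2 le_top)
  have hd : DifferentiableAt ℝ (fderiv ℝ f) x :=
    (hf.fderiv_right (m := ∞) (by simp)).differentiableAt (by simp)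
  have key : ∀ κ l : Fin 4, pd κ (pd l f) x =
      fderiv ℝ (fderiv ℝ f) x (EuclideanSpace.single κ 1) (EuclideanSpace.single l 1) := by
    intro κ l
    have := (hd.hasFDerivAt.clm_apply (hasFDerivAt_const (EuclideanSpace.single l (1 : ℝ)) x)).fderiv
    change fderiv ℝ (fun y => fderiv ℝ f y (EuclideanSpace.single l 1)) x _ = _
    rw [this]
    simp
  rw [key, key]
  exact hs _ _

theorem contDiff_pd {X : Type*} [NormedAddCommGroup X] [NormedSpace ℝ X] {f : R4 → X}
    (hf : ContDiff ℝ ∞ f) (μ : Fin 4) : ContDiff ℝ ∞ (pd μ f) :=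
  (hf.fderiv_right (m := ∞) (by simp)).clm_apply contDiff_const

theorem pd_clm {X Y : Type*} [NormedAddCommGroup X] [NormedSpace ℝ X] [NormedAddCommGroup Y]
    [NormedSpace ℝ Y] (L : X →L[ℝ] Y) {f : R4 → X} {x : R4} (hf : DifferentiableAt ℝ f x)
    (μ : Fin 4) : pd μ (fun x => L (f x)) x = L (pd μ f x) := by
  have := (L.hasFDerivAt.comp x hf.hasFDerivAt).fderiv
  change fderiv ℝ (L ∘ f) x _ = _
  rw [this]
  rfl

theorem pd_add {X : Type*} [NormedAddCommGroup X] [NormedSpace ℝ X] {f g : R4 → X} {x : R4}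
    (hf : DifferentiableAt ℝ f x) (hg : DifferentiableAt ℝ g x) (μ : Fin 4) :
    pd μ (fun x => f x + g x) x = pd μ f x + pd μ g x := by
  rw [pd, fderiv_fun_add hf hg]
  rfl

theorem pd_sub {X : Type*} [NormedAddCommGroup X] [NormedSpace ℝ X] {f g : R4 → X} {x : R4}
    (hf : DifferentiableAt ℝ f x) (hg : DifferentiableAt ℝ g x) (μ : Fin 4) :
    pd μ (fun x => f x - g x) x = pd μ f x - pd μ g x := by
  rw [pd, fderiv_fun_sub hf hg]
  rfl

theorem pd_bilinear {X Y Z : Type*} [NormedAddCommGroup X] [NormedSpace ℝ X]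
    [NormedAddCommGroup Y] [NormedSpace ℝ Y] [NormedAddCommGroup Z] [NormedSpace ℝ Z]
    (L : X →L[ℝ] Y →L[ℝ] Z) {f : R4 → X} {g : R4 → Y} {x : R4}
    (hf : DifferentiableAt ℝ f x) (hg : DifferentiableAt ℝ g x) (μ : Fin 4) :
    pd μ (fun x => L (f x) (g x)) x = L (f x) (pd μ g x) + L (pd μ f x) (g x) := by
  rw [pd, (L.hasFDerivAt_of_bilinear hf.hasFDerivAt hg.hasFDerivAt).fderiv]
  rfl

theorem pd_smul {X : Type*} [NormedAddCommGroup X] [NormedSpace ℂ X] {f : R4 → ℂ} {g : R4 → X}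
    {x : R4} (hf : DifferentiableAt ℝ f x) (hg : DifferentiableAt ℝ g x) (μ : Fin 4) :
    pd μ (fun x => f x • g x) x = f x • pd μ g x + pd μ f x • g x :=
  pd_bilinear (ContinuousLinearMap.lsmul ℝ ℂ) hf hg μ

theorem actE_add {n : ℕ} (T : V n →L[ℂ] V n) (v w : W n) :
    actE T (v + w) = actE T v + actE T w := by
  ext a : 1
  simp [actE]

theorem actE_smul {n : ℕ} (T : V n →L[ℂ] V n) (c : ℂ) (w : W n) :
    actE T (c • w) = c • actE T w := by
  ext a : 1
  simp [actE]

theorem actS_add {n : ℕ} (M : Matrix (Fin 2) (Fin 2) ℂ) (v w : W n) :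
    actS M (v + w) = actS M v + actS M w := by
  ext a : 1
  simp [actS, Finset.sum_add_distrib]

theorem actS_smul {n : ℕ} (M : Matrix (Fin 2) (Fin 2) ℂ) (c : ℂ) (w : W n) :
    actS M (c • w) = c • actS M w := by
  ext a : 1
  simp only [actS, PiLp.smul_apply, Finset.smul_sum]
  exact Finset.sum_congr rfl fun b _ => smul_comm _ _ _

namespace HermitianBundle

variable {B : SmoothDomain} {n : ℕ} (E : HermitianBundle B n)

/-! ### Phases intertwine the Dirac operators -/

theorem contDiff_phase (z : R4) : ContDiff ℝ ∞ (phase z) := by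
  have h : ∀ μ : Fin 4, ContDiff ℝ ∞ fun x : R4 => ((x μ : ℝ) : ℂ) := fun μ =>
    Complex.ofRealCLM.contDiff.comp (EuclideanSpace.proj (𝕜 := ℝ) μ).contDiff
  exact (contDiff_const.mul (ContDiff.sum fun μ _ => contDiff_const.mul (h μ))).cexp

theorem pd_phase (z : R4) (μ : Fin 4) (x : R4) :
    pd μ (phase z) x = -(2 * Real.pi * Complex.I) * z μ * phase z x := by
  have h : ∀ κ : Fin 4, HasFDerivAt (fun x : R4 => ((x κ : ℝ) : ℂ))
      (Complex.ofRealCLM ∘L EuclideanSpace.proj (𝕜 := ℝ) κ) x := fun κ =>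
    (Complex.ofRealCLM ∘L EuclideanSpace.proj (𝕜 := ℝ) κ).hasFDerivAt
  have h2 := ((HasFDerivAt.fun_sum fun κ (_ : κ ∈ Finset.univ) =>
    (h κ).const_mul (z κ : ℂ)).const_mul (-(2 * Real.pi * Complex.I))).cexp
  change fderiv ℝ (fun x : R4 =>
    Complex.exp (-(2 * Real.pi * Complex.I) * ∑ μ, (z μ : ℂ) * (x μ : ℂ))) x _ = _
  rw [h2.fderiv]
  have h3 : ∑ κ, (z κ : ℂ) * ((EuclideanSpace.single μ (1 : ℝ) κ : ℝ) : ℂ) = z μ := by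
    rw [Finset.sum_eq_single μ] <;> simp +contextual
  rw [← h3]
  simp only [phase, ContinuousMap.coe_mk, _root_.smul_apply, _root_.sum_apply, smul_eq_mul,
    ContinuousLinearMap.comp_apply, Complex.ofRealCLM_apply, PiLp.proj_apply]
  ring

/-- The derivative of the phase contributes `2πi z_μ`, which is exactly the shift of the connection
from `A_w` to `A_{w+z}`. -/
theorem covDeriv_phase (i : ℕ) (w z : R4) (μ : Fin 4) {φ : R4 → W n} {x : R4}
    (hφ : DifferentiableAt ℝ φ x) :
    E.covDeriv i w μ (fun y => phase (-z) y • φ y) x =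
      phase (-z) x • E.covDeriv i (w + z) μ φ x := by
  rw [covDeriv, covDeriv, pd_smul ((contDiff_phase _).differentiable (by simp) x) hφ, pd_phase,
    actE_smul]
  simp only [PiLp.add_apply, PiLp.neg_apply, Complex.ofReal_mul, Complex.ofReal_add,
    Complex.ofReal_neg, Complex.ofReal_ofNat]
  module

theorem diracPlus_phase (i : ℕ) (w z : R4) {φ : R4 → W n} {x : R4}
    (hφ : DifferentiableAt ℝ φ x) :
    E.diracPlus i w (fun y => phase (-z) y • φ y) x =
      phase (-z) x • E.diracPlus i (w + z) φ x := by
  simp only [diracPlus, E.covDeriv_phase i w z _ hφ, actS_smul, Finset.smul_sum]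

theorem isTest_phase (i : ℕ) (z : R4) {φ : R4 → W n} (hφ : E.IsTest i φ) :
    E.IsTest i fun y => phase z y • φ y := by
  refine ⟨(contDiff_phase z).smul hφ.1, ?_, ?_⟩
  · exact HasCompactSupport.smul_left (f := fun y => phase z y) hφ.2.1
  · exact (tsupport_smul_subset_right (fun y => phase z y) φ).trans hφ.2.2

/-! ### Fibres and projections as phase translates of the Bergmann space. -/

/-- The phase is moved across the inner product onto `D⁺φ`, where it becomes the conjugate phase and
can be absorbed into the test function. Test functions are stable under this. -/
theorem mulOp_phase_mem (w z : R4) {s : E.L2} (hs : s ∈ E.nahmFibre w) :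
    E.mulOp (phase z) s ∈ E.nahmFibre (w + z) := by
  intro i φ hφ
  rw [← hs i _ (E.isTest_phase i (-z) hφ)]
  have hle : volume.restrict (E.U i ∩ B.carrier) ≤ (volume : Measure R4).restrict B.carrier :=
    Measure.restrict_mono_set _ inter_subset_right
  refine integral_congr_ae ?_
  filter_upwards [(Measure.absolutelyContinuous_of_le hle).ae_eq (E.mulOp_apply_ae (phase z) s)]
    with x hx
  rw [comp, hx, E.diracPlus_phase i w z (hφ.1.differentiable (by simp) x), actE_smul,
    inner_smul_left, inner_smul_right, comp, ← star_phase]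
  simp

theorem mulOp_phase_mem_nahmFibre (z : R4) {s : E.L2} (hs : s ∈ E.bergmann) :
    E.mulOp (phase z) s ∈ E.nahmFibre z := by
  simpa using E.mulOp_phase_mem 0 z hs

theorem mulOp_neg_phase_mem_bergmann (z : R4) {s : E.L2} (hs : s ∈ E.nahmFibre z) :
    E.mulOp (phase (-z)) s ∈ E.bergmann := by
  simpa using E.mulOp_phase_mem z (-z) hs

theorem nahmFibre_eq_map (z : R4) :
    E.nahmFibre z = E.bergmann.map (E.mulOp (phase z)).toLinearMap := by
  ext s
  constructor
  · intro hs
    exact ⟨_, E.mulOp_neg_phase_mem_bergmann z hs, E.mulOp_phase_neg z s⟩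
  · rintro ⟨t, ht, rfl⟩
    exact E.mulOp_phase_mem_nahmFibre z ht

/-- A unitary that carries one closed subspace onto another conjugates the orthogonal projections.
-/
theorem proj_apply (z : R4) (s : E.L2) :
    E.proj z s = E.mulOp (phase z) (E.proj 0 (E.mulOp (phase (-z)) s)) := by
  refine Submodule.eq_starProjection_of_mem_orthogonal
    (E.mulOp_phase_mem_nahmFibre z (Submodule.starProjection_apply_mem _ _)) ?_
  rw [Submodule.mem_orthogonal']
  intro t ht
  have h := Submodule.starProjection_inner_eq_zero (K := E.bergmann) (E.mulOp (phase (-z)) s) _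
    (E.mulOp_neg_phase_mem_bergmann z ht)
  rw [← E.mulOp_phase_neg z s, ← map_sub, inner_mulOp_phase, E.mulOp_phase_neg]
  exact h

theorem contDiff_proj : ContDiff ℝ ∞ E.proj := by
  have h : E.proj = fun z => E.mulOp (phase z) * E.proj 0 * E.mulOp (phase (-z)) := by
    funext z
    ext1 s
    exact E.proj_apply z s
  rw [h]
  exact (E.contDiff_mulOp_phase.mul contDiff_const).mul (E.contDiff_mulOp_phase.comp contDiff_neg)

theorem contDiff_mulOp_phase_apply {τ : R4 → E.L2} (hτ : ContDiff ℝ ∞ τ) :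
    ContDiff ℝ ∞ fun z => E.mulOp (phase z) (τ z) := by
  let R : (E.L2 →L[ℂ] E.L2) →L[ℝ] (E.L2 →L[ℝ] E.L2) :=
    ContinuousLinearMap.restrictScalarsL ℂ E.L2 E.L2 ℝ ℝ
  exact (R.contDiff.comp E.contDiff_mulOp_phase).clm_apply hτ

/-! ### The connection and its curvature in the trivialisation given by the phases -/

theorem contDiff_coe_bergmann {σ : R4 → E.bergmann} (hσ : ContDiff ℝ ∞ σ) :
    ContDiff ℝ ∞ fun z => (σ z : E.L2) :=
  (E.bergmann.subtypeL.restrictScalars ℝ).contDiff.comp hσ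

theorem isSmoothSection_mulOp_phase {σ : R4 → E.bergmann} (hσ : ContDiff ℝ ∞ σ) :
    E.IsSmoothSection fun z => E.mulOp (phase z) (σ z) :=
  ⟨E.contDiff_mulOp_phase_apply (E.contDiff_coe_bergmann hσ),
    fun z => E.mulOp_phase_mem_nahmFibre z (σ z).2⟩

/-- Since `P_z U_z = U_z P_0`, projecting the product rule leaves `∂_μ σ` fixed and turns `x_μ σ`
into `x̂_μ σ`. -/
theorem nahmConn_mulOp_phase {σ : R4 → E.bergmann} (hσ : ContDiff ℝ ∞ σ) (μ : Fin 4) (z : R4) :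
    E.nahmConn μ (fun z => E.mulOp (phase z) (σ z)) z =
      E.mulOp (phase z)
        (pd μ σ z - (2 * Real.pi * Complex.I : ℂ) • E.xhat μ (σ z) : E.bergmann) := by
  have h1 : pd μ (fun z => (σ z : E.L2)) z = (pd μ σ z : E.bergmann) :=
    pd_clm (E.bergmann.subtypeL.restrictScalars ℝ) (hσ.differentiable (by simp) z) μ
  rw [nahmConn, E.pd_mulOp_phase_apply ((E.contDiff_coe_bergmann hσ).differentiable (by simp)),
    proj_apply, mulOp_neg_phase, h1, map_sub, map_smul]
  have h2 : E.proj 0 (pd μ σ z : E.bergmann) = (pd μ σ z : E.bergmann) :=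
    Submodule.starProjection_eq_self_iff.2 (pd μ σ z).2
  rw [h2]
  rfl

/-- The covariant derivative of `Ê` in the trivialisation given by the phases. -/
def bergmannConn (μ : Fin 4) (σ : R4 → E.bergmann) (z : R4) : E.bergmann :=
  pd μ σ z - (2 * Real.pi * Complex.I : ℂ) • E.xhat μ (σ z)

theorem contDiff_bergmannConn (μ : Fin 4) {σ : R4 → E.bergmann} (hσ : ContDiff ℝ ∞ σ) :
    ContDiff ℝ ∞ (E.bergmannConn μ σ) :=
  (contDiff_pd hσ μ).sub
    ((((2 * Real.pi * Complex.I : ℂ) • E.xhat μ).restrictScalars ℝ).contDiff.comp hσ)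

/-- The second-derivative and first-order terms are symmetric in `μ, ν`, so only the product `x̂_μ
x̂_ν` survives antisymmetrisation. -/
theorem bergmannConn_bergmannConn (μ ν : Fin 4) {σ : R4 → E.bergmann} (hσ : ContDiff ℝ ∞ σ)
    (z : R4) :
    E.bergmannConn μ (E.bergmannConn ν σ) z = pd μ (pd ν σ) z
      - (2 * Real.pi * Complex.I : ℂ) • (E.xhat ν (pd μ σ z) + E.xhat μ (pd ν σ z))
      + (2 * Real.pi * Complex.I : ℂ) ^ 2 • E.xhat μ (E.xhat ν (σ z)) := by
  have hd := hσ.differentiable (by simp) z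
  have h1 : pd μ (E.bergmannConn ν σ) z =
      pd μ (pd ν σ) z - (2 * Real.pi * Complex.I : ℂ) • E.xhat ν (pd μ σ z) := by
    have h2 := pd_sub ((contDiff_pd hσ ν).differentiable (by simp) z)
      ((((2 * Real.pi * Complex.I : ℂ) • E.xhat ν).restrictScalars ℝ).differentiableAt.comp z hd) μ
    have h3 := pd_clm (((2 * Real.pi * Complex.I : ℂ) • E.xhat ν).restrictScalars ℝ) hd μ
    refine h2.trans (congrArg₂ _ rfl h3)
  rw [bergmannConn, h1, bergmannConn, map_sub, map_smul]
  module

theorem nahmCurvature_mulOp_phase {σ : R4 → E.bergmann} (hσ : ContDiff ℝ ∞ σ) (μ ν : Fin 4)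
    (z : R4) :
    E.nahmCurvature μ ν (fun z => E.mulOp (phase z) (σ z)) z =
      E.mulOp (phase z) (((2 * Real.pi * Complex.I : ℂ) ^ 2 •
        (E.xhat μ * E.xhat ν - E.xhat ν * E.xhat μ) (σ z) : E.bergmann)) := by
  have h : ∀ κ, E.nahmConn κ (fun z => E.mulOp (phase z) (σ z)) =
      fun z => E.mulOp (phase z) (E.bergmannConn κ σ z) := fun κ =>
    funext fun z => E.nahmConn_mulOp_phase hσ κ z
  have h2 : ∀ κ l, E.nahmConn κ (E.nahmConn l (fun z => E.mulOp (phase z) (σ z))) z =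
      E.mulOp (phase z) (E.bergmannConn κ (E.bergmannConn l σ) z) := by
    intro κ l
    rw [h l]
    exact E.nahmConn_mulOp_phase (E.contDiff_bergmannConn l hσ) κ z
  rw [nahmCurvature, h2, h2, ← map_sub, ← Submodule.coe_sub, E.bergmannConn_bergmannConn μ ν hσ,
    E.bergmannConn_bergmannConn ν μ hσ, pd_comm hσ.contDiffAt μ ν]
  congr 2
  rw [_root_.sub_apply, mul_apply_eq_comp, mul_apply_eq_comp]
  module

/-- Every smooth section of `Ê` is a phase times a smooth function with values in the Bergmann
space. -/
theorem exists_eq_mulOp_phase {ψ : R4 → E.L2} (hψ : E.IsSmoothSection ψ) :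
    ∃ σ : R4 → E.bergmann, ContDiff ℝ ∞ σ ∧ ψ = fun z => E.mulOp (phase z) (σ z) := by
  have h1 : ContDiff ℝ ∞ fun z => E.mulOp (phase (-z)) (ψ z) := by
    -- The smooth map `z ↦ U_z ψ(-z)` is composed with `z ↦ -z`.
    have := (E.contDiff_mulOp_phase_apply (hψ.1.comp contDiff_neg)).comp contDiff_neg
    simpa [Function.comp_def] using this
  refine ⟨fun z => E.bergmann.orthogonalProjectionOnto (E.mulOp (phase (-z)) (ψ z)),
    (E.bergmann.orthogonalProjectionOnto.restrictScalars ℝ).contDiff.comp h1, ?_⟩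
  funext z
  have h2 : E.bergmann.starProjection (E.mulOp (phase (-z)) (ψ z)) = E.mulOp (phase (-z)) (ψ z) :=
    Submodule.starProjection_eq_self_iff.2 (E.mulOp_neg_phase_mem_bergmann z (hψ.2 z))
  change _ = E.mulOp (phase z) (E.bergmann.starProjection _)
  rw [h2, mulOp_phase_neg]

theorem nahmIsASD_iff_aDHMEquations : E.NahmIsASD ↔ E.ADHMEquations := by
  have hc : (2 * Real.pi * Complex.I : ℂ) ^ 2 ≠ 0 := by
    simp [Real.pi_ne_zero]
  have key : ∀ (σ : R4 → E.bergmann), ContDiff ℝ ∞ σ → ∀ z μ ν κ l,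
      E.nahmCurvature μ ν (fun z => E.mulOp (phase z) (σ z)) z +
        E.nahmCurvature κ l (fun z => E.mulOp (phase z) (σ z)) z = 0 ↔
      ((E.xhat μ * E.xhat ν - E.xhat ν * E.xhat μ) +
        (E.xhat κ * E.xhat l - E.xhat l * E.xhat κ)) (σ z) = 0 := by
    intro σ hσ z μ ν κ l
    rw [E.nahmCurvature_mulOp_phase hσ, E.nahmCurvature_mulOp_phase hσ, ← map_add,
      ← Submodule.coe_add, ← smul_add, _root_.add_apply]
    constructor
    · intro h
      have h2 := congrArg (E.mulOp (phase (-z))) h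
      rw [mulOp_neg_phase, map_zero, Submodule.coe_eq_zero] at h2
      exact (smul_eq_zero.1 h2).resolve_left hc
    · intro h
      rw [h, smul_zero, Submodule.coe_zero, map_zero]
  constructor
  · intro h
    -- The curvature operators in the phase trivialisation do not depend on `z`, so constant
    -- functions evaluated at `z = 0` detect them.
    have h' := fun v : E.bergmann =>
      h _ (E.isSmoothSection_mulOp_phase (σ := fun _ => v) contDiff_const) 0
    refine ⟨?_, ?_, ?_⟩ <;> ext1 v
    · exact (key _ contDiff_const 0 _ _ _ _).1 (h' v).1
    · exact (key _ contDiff_const 0 _ _ _ _).1 (h' v).2.1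
    · exact (key _ contDiff_const 0 _ _ _ _).1 (h' v).2.2
  · rintro ⟨h1, h2, h3⟩ ψ hψ z
    obtain ⟨σ, hσ, rfl⟩ := E.exists_eq_mulOp_phase hψ
    refine ⟨(key σ hσ z _ _ _ _).2 ?_, (key σ hσ z _ _ _ _).2 ?_, (key σ hσ z _ _ _ _).2 ?_⟩
    · exact congrArg (fun T : E.bergmann →L[ℂ] E.bergmann => T (σ z)) h1
    · exact congrArg (fun T : E.bergmann →L[ℂ] E.bergmann => T (σ z)) h2
    · exact congrArg (fun T : E.bergmann →L[ℂ] E.bergmann => T (σ z)) h3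

end HermitianBundle

end LocalNahm

namespace LocalNahm

/-! ### Operators determined on the range of a densely defined map -/

section Hilbert

variable {H F T : Type*} [NormedAddCommGroup H] [InnerProductSpace ℂ H] [CompleteSpace H]
  [NormedAddCommGroup F] [NormedSpace ℂ F] [AddCommMonoid T] [Module ℂ T]

/-- The space is the sum of the closure of the range and its orthogonal complement, and equality on
the range passes to the closure by continuity. -/
theorem clm_ext_range (D : T →ₗ[ℂ] H) {A A' : H →L[ℂ] F} (h : ∀ φ, A (D φ) = A' (D φ))
    (h' : ∀ u ∈ (LinearMap.range D)ᗮ, A u = A' u) : A = A' := by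
  have hR : ∀ u ∈ (LinearMap.range D).topologicalClosure, A u = A' u := by
    intro u hu
    have hcl : IsClosed {u | A u = A' u} := isClosed_eq A.continuous A'.continuous
    refine closure_minimal ?_ hcl hu
    rintro _ ⟨φ, rfl⟩
    exact h φ
  ext1 u
  have h1 := hR _ (Submodule.starProjection_apply_mem (LinearMap.range D).topologicalClosure u)
  have h2 := (LinearMap.range D).topologicalClosure.sub_starProjection_mem_orthogonal u
  rw [Submodule.orthogonal_closure] at h2
  have h3 := h' _ h2
  rw [← sub_add_cancel u ((LinearMap.range D).topologicalClosure.starProjection u), map_add,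
    map_add, h1, h3]

/-- By the bound, `D φ ↦ J φ` is well defined and continuous on the range. It extends to the
closure, and precomposing with the orthogonal projection makes it zero on the complement. -/
theorem exists_clm_extension [CompleteSpace F] (D : T →ₗ[ℂ] H) (J : T →ₗ[ℂ] F) {C : ℝ}
    (hC : ∀ φ, ‖J φ‖ ≤ C * ‖D φ‖) :
    ∃ K : H →L[ℂ] F, (∀ φ, K (D φ) = J φ) ∧ ∀ u ∈ (LinearMap.range D)ᗮ, K u = 0 := by
  -- Multiplication by the scalar `-1` supplies negatives in `T`.
  let _ : AddCommGroup T := Module.addCommMonoidToAddCommGroup ℂ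
  let R := (LinearMap.range D).topologicalClosure
  let e : T →ₗ[ℂ] R := D.codRestrict R fun φ =>
    (LinearMap.range D).le_topologicalClosure ⟨φ, rfl⟩
  have hd : DenseRange e := by
    intro r
    rw [closure_subtype]
    have : ((↑) '' range e : Set H) = LinearMap.range D := by
      rw [← range_comp]
      rfl
    rw [this]
    exact r.2
  refine ⟨(J.extendOfNorm e) ∘L R.orthogonalProjectionOnto, fun φ => ?_, fun u hu => ?_⟩
  · have h1 : R.orthogonalProjectionOnto (D φ) = e φ :=
      Submodule.orthogonalProjectionOnto_mem_subspace_eq_self (e φ)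
    rw [ContinuousLinearMap.comp_apply, h1]
    exact LinearMap.extendOfNorm_eq hd ⟨C, hC⟩ φ
  · have h1 : R.orthogonalProjectionOnto u = 0 := by
      rw [Submodule.orthogonalProjectionOnto_eq_zero_iff, Submodule.orthogonal_closure]
      exact hu
    rw [ContinuousLinearMap.comp_apply, h1, map_zero]

/-- This identifies a weak solution `r` of `D* r = J* f` lying in the closed range of `D` with `K*
f`: the functionals `⟨r, ·⟩` and `⟨f, K ·⟩` agree on the range and both vanish on its complement. -/
theorem eq_adjoint_apply_of_range {F : Type*} [NormedAddCommGroup F] [InnerProductSpace ℂ F]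
    [CompleteSpace F] (D : T →ₗ[ℂ] H) {J : T →ₗ[ℂ] F} {K : H →L[ℂ] F}
    (hK : ∀ φ, K (D φ) = J φ) (hK' : ∀ u ∈ (LinearMap.range D)ᗮ, K u = 0) {r : H} {f : F}
    (hr : r ∈ (LinearMap.range D)ᗮᗮ) (h : ∀ φ, inner ℂ r (D φ) = inner ℂ f (J φ)) :
    r = ContinuousLinearMap.adjoint K f := by
  have h1 : innerSL ℂ r = innerSL ℂ f ∘L K := by
    refine clm_ext_range D (fun φ => ?_) fun u hu => ?_
    · simp only [innerSL_apply_apply, ContinuousLinearMap.comp_apply, h, hK]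
    · simp only [innerSL_apply_apply, ContinuousLinearMap.comp_apply, hK' u hu, inner_zero_right]
      exact Submodule.inner_left_of_mem_orthogonal hu hr
  refine ext_inner_right ℂ fun u => ?_
  rw [ContinuousLinearMap.adjoint_inner_left]
  exact congrArg (fun L : H →L[ℂ] ℂ => L u) h1

theorem adjoint_eq_of_range (D : T →ₗ[ℂ] H) {M₁ M₂ : H →L[ℂ] H} {Mt Mt' : T →ₗ[ℂ] T}
    (h₁ : ∀ φ, M₁ (D φ) = D (Mt φ)) (h₁' : ∀ u ∈ (LinearMap.range D)ᗮ, M₁ u = 0)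
    (h₂ : ∀ φ, M₂ (D φ) = D (Mt' φ)) (h₂' : ∀ u ∈ (LinearMap.range D)ᗮ, M₂ u = 0)
    (hadj : ∀ φ ψ, inner ℂ (D (Mt φ)) (D ψ) = inner ℂ (D φ) (D (Mt' ψ))) :
    ContinuousLinearMap.adjoint M₂ = M₁ := by
  refine clm_ext_range D (fun φ => ?_) fun u hu => ?_
  · rw [h₁]
    refine (eq_adjoint_apply_of_range D (J := D ∘ₗ Mt') h₂ h₂' ?_ fun ψ => hadj φ ψ).symm
    exact Submodule.le_orthogonal_orthogonal _ ⟨_, rfl⟩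
  · rw [h₁' u hu]
    refine (eq_adjoint_apply_of_range D (J := D ∘ₗ Mt') h₂ h₂' (zero_mem _) fun ψ => ?_).symm
    rw [inner_zero_left]
    exact (Submodule.inner_left_of_mem_orthogonal
      (LinearMap.mem_range_self D (Mt' ψ)) hu).symm

/-- If `J = K D`, if `M` is intertwined by `J` with `Mt`, and if `Mt` has the formal adjoint `Mt'`
with respect to the form `⟨D φ, D ψ⟩`, then the Green operator `K K*` commutes with `M`. -/
theorem green_comm (D J : T →ₗ[ℂ] H) {K : H →L[ℂ] H} (hK : ∀ φ, K (D φ) = J φ)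
    (hK' : ∀ u ∈ (LinearMap.range D)ᗮ, K u = 0) (M : H →L[ℂ] H) {Mt Mt' : T →ₗ[ℂ] T}
    (hM : ∀ φ, J (Mt φ) = M (J φ)) (hM' : ∀ φ, J (Mt' φ) = ContinuousLinearMap.adjoint M (J φ))
    {C C' : ℝ} (hC : ∀ φ, ‖D (Mt φ)‖ ≤ C * ‖D φ‖) (hC' : ∀ φ, ‖D (Mt' φ)‖ ≤ C' * ‖D φ‖)
    (hadj : ∀ φ ψ, inner ℂ (D (Mt φ)) (D ψ) = inner ℂ (D φ) (D (Mt' ψ))) (f : H) :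
    K (ContinuousLinearMap.adjoint K (M f)) = M (K (ContinuousLinearMap.adjoint K f)) := by
  -- `M₁` and `M₂` are the bounded operators `D φ ↦ D (Mt φ)` and `D φ ↦ D (Mt' φ)`. They are
  -- adjoint to each other, `K M₁ = M K`, and the adjoint of `K M₂ = M* K` is `M₁ K* = K* M`. Hence
  -- `K K* M = K M₁ K* = M K K*`.
  obtain ⟨M₁, h₁, h₁'⟩ := exists_clm_extension D (D ∘ₗ Mt) hC
  obtain ⟨M₂, h₂, h₂'⟩ := exists_clm_extension D (D ∘ₗ Mt') hC'
  have hadj' := adjoint_eq_of_range D h₁ h₁' h₂ h₂' hadj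
  have e₁ : K ∘L M₁ = M ∘L K := by
    refine clm_ext_range D (fun φ => ?_) fun u hu => ?_
    · simp only [ContinuousLinearMap.comp_apply, h₁, LinearMap.comp_apply, hK, hM]
    · simp only [ContinuousLinearMap.comp_apply, h₁' u hu, hK' u hu, map_zero]
  have e₂ : K ∘L M₂ = ContinuousLinearMap.adjoint M ∘L K := by
    refine clm_ext_range D (fun φ => ?_) fun u hu => ?_
    · simp only [ContinuousLinearMap.comp_apply, h₂, LinearMap.comp_apply, hK, hM']
    · simp only [ContinuousLinearMap.comp_apply, h₂' u hu, hK' u hu, map_zero]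
  have e₃ : M₁ ∘L ContinuousLinearMap.adjoint K = ContinuousLinearMap.adjoint K ∘L M := by
    have := congrArg ContinuousLinearMap.adjoint e₂
    rwa [ContinuousLinearMap.adjoint_comp, ContinuousLinearMap.adjoint_comp, hadj',
      ContinuousLinearMap.adjoint_adjoint] at this
  have e₄ := congrArg (fun L : H →L[ℂ] H => K (L f)) e₃
  have e₅ := congrArg (fun L : H →L[ℂ] H => L (ContinuousLinearMap.adjoint K f)) e₁
  simp only [ContinuousLinearMap.comp_apply] at e₄ e₅
  rw [← e₄, e₅]

end Hilbert

end LocalNahm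

namespace LocalNahm

/-! ### Linear algebra of the fibres -/

section Fibre

variable {n : ℕ}

theorem norm_actE_le (T : V n →L[ℂ] V n) (w : W n) : ‖actE T w‖ ≤ ‖T‖ * ‖w‖ := by
  rw [← sq_le_sq₀ (norm_nonneg _) (by positivity), mul_pow, PiLp.norm_sq_eq_of_L2,
    PiLp.norm_sq_eq_of_L2, Finset.mul_sum]
  refine Finset.sum_le_sum fun a _ => ?_
  rw [← mul_pow]
  exact pow_le_pow_left₀ (norm_nonneg _) (T.le_opNorm _) 2

/-- The action of endomorphisms of the fibre of `E` as a bounded bilinear map. -/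
def actEL : (V n →L[ℂ] V n) →L[ℝ] W n →L[ℝ] W n :=
  (LinearMap.mk₂ ℝ (fun (T : V n →L[ℂ] V n) (w : W n) => actE T w)
    (fun S T w => by ext a : 1; simp [actE])
    (fun c T w => by ext a : 1; simp [actE])
    (fun T v w => actE_add T v w)
    (fun c T w => by ext a : 1; simp [actE])).mkContinuous₂ 1
    fun T w => by simpa using norm_actE_le T w

/-- The action of a matrix on spinors as a bounded operator. -/
def actSL (M : Matrix (Fin 2) (Fin 2) ℂ) : W n →L[ℂ] W n where
  toFun := actS M
  map_add' := actS_add M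
  map_smul' := actS_smul M
  cont := HermitianBundle.continuous_actS M

theorem actSL_apply (M : Matrix (Fin 2) (Fin 2) ℂ) (w : W n) : actSL M w = actS M w := rfl

theorem add_actE (S T : V n →L[ℂ] V n) (w : W n) : actE (S + T) w = actE S w + actE T w := by
  ext a : 1
  simp [actE]

theorem neg_actE (T : V n →L[ℂ] V n) (w : W n) : actE (-T) w = -actE T w := by
  ext a : 1
  simp [actE]

theorem sub_actE (S T : V n →L[ℂ] V n) (w : W n) : actE (S - T) w = actE S w - actE T w := by
  ext a : 1
  simp [actE]

theorem mul_actE (S T : V n →L[ℂ] V n) (w : W n) : actE (S * T) w = actE S (actE T w) := rfl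

theorem one_actE (w : W n) : actE 1 w = w := rfl

theorem zero_actE (w : W n) : actE 0 w = 0 := rfl

theorem actE_zero (T : V n →L[ℂ] V n) : actE T (0 : W n) = 0 := by
  ext a : 1
  simp [actE]

theorem actE_actS (T : V n →L[ℂ] V n) (M : Matrix (Fin 2) (Fin 2) ℂ) (w : W n) :
    actE T (actS M w) = actS M (actE T w) := by
  ext a : 1
  simp [actE, actS]

theorem mul_actS (M N : Matrix (Fin 2) (Fin 2) ℂ) (w : W n) :
    actS (M * N) w = actS M (actS N w) := by
  ext a : 1
  simp only [actS, Matrix.mul_apply, Finset.sum_smul, Finset.smul_sum, smul_smul]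
  exact Finset.sum_comm

theorem add_actS (M N : Matrix (Fin 2) (Fin 2) ℂ) (w : W n) :
    actS (M + N) w = actS M w + actS N w := by
  ext a : 1
  simp [actS, add_smul, Finset.sum_add_distrib]

theorem smul_actS (c : ℂ) (M : Matrix (Fin 2) (Fin 2) ℂ) (w : W n) :
    actS (c • M) w = c • actS M w := by
  ext a : 1
  simp [actS, mul_smul]

theorem one_actS (w : W n) : actS 1 w = w := by
  ext a : 1
  simp [actS, Matrix.one_apply]

theorem inner_actS (M : Matrix (Fin 2) (Fin 2) ℂ) (v w : W n) :
    inner ℂ (actS M v) w = inner ℂ v (actS Mᴴ w) := by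
  simp only [PiLp.inner_apply (𝕜 := ℂ) (f := fun _ : Fin 2 => V n), actS, sum_inner, inner_sum,
    inner_smul_left, inner_smul_right, Matrix.conjTranspose_apply]
  exact Finset.sum_comm

theorem inner_actE_of_skew {T : V n →L[ℂ] V n} (hT : T ∈ skewAdjoint (V n →L[ℂ] V n))
    (v w : W n) : inner ℂ (actE T v) w = -inner ℂ v (actE T w) := by
  rw [HermitianBundle.inner_actE, skewAdjoint.mem_iff.1 hT, neg_actE, inner_neg_left, neg_neg]

theorem inner_actE_actE_of_unitary {T : V n →L[ℂ] V n} (hT : T ∈ unitary (V n →L[ℂ] V n))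
    (v w : W n) : inner ℂ (actE T v) (actE T w) = inner ℂ v w := by
  rw [HermitianBundle.inner_actE, ← mul_actE, (Unitary.mem_iff.1 hT).1, one_actE]

end Fibre

/-! ### Partial derivatives on open sets, and their integrals. -/

theorem contDiffOn_pd {X : Type*} [NormedAddCommGroup X] [NormedSpace ℝ X] {f : R4 → X}
    {s : Set R4} (hf : ContDiffOn ℝ ∞ f s) (hs : IsOpen s) (μ : Fin 4) :
    ContDiffOn ℝ ∞ (pd μ f) s :=
  (hf.fderiv_of_isOpen hs (m := ∞) (by simp)).clm_apply contDiffOn_const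

theorem pd_congr {X : Type*} [NormedAddCommGroup X] [NormedSpace ℝ X] {f g : R4 → X} {x : R4}
    (h : f =ᶠ[nhds x] g) (μ : Fin 4) : pd μ f x = pd μ g x := by
  rw [pd, h.fderiv_eq, pd]

/-- The integral of a partial derivative of a compactly supported function vanishes. -/
theorem integral_pd_eq_zero {f : R4 → ℂ} (hf : ContDiff ℝ 1 f) (hc : HasCompactSupport f)
    (μ : Fin 4) : ∫ x, pd μ f x = 0 := by
  have hpd : Continuous (pd μ f) := (hf.continuous_fderiv (by simp)).clm_apply continuous_const
  have hpc : HasCompactSupport (pd μ f) :=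
    (hc.fderiv ℝ).comp_left (g := fun L : R4 →L[ℝ] ℂ => L (EuclideanSpace.single μ 1)) rfl
  have hpi : Integrable (fun x => fderiv ℝ f x (EuclideanSpace.single μ 1)) :=
    hpd.integrable_of_hasCompactSupport hpc
  have hfi : Integrable f := hf.continuous.integrable_of_hasCompactSupport hc
  -- Integration by parts against the constant function `1`.
  have h := integral_smul_fderiv_eq_neg_fderiv_smul_of_integrable (𝕜 := ℝ) (μ := volume)
    (f := fun _ : R4 => (1 : ℝ)) (g := f) (v := EuclideanSpace.single μ 1)
    (by simp) (by simpa using hpi) (by simpa using hfi)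
    (fun _ _ => differentiableAt_const _) (fun x _ => hf.differentiable (by simp) x)
  simpa [pd] using h

namespace HermitianBundle

variable {B : SmoothDomain} {n : ℕ} (E : HermitianBundle B n)

/-! ### Changes of trivialisation -/

theorem isOpen_inter (i : ℕ) : IsOpen (E.U i ∩ B.carrier) := (E.isOpen_U i).inter B.isOpen

theorem g_self {i : ℕ} {x : R4} (hi : x ∈ E.U i) (hx : x ∈ B.carrier) : E.g i i x = 1 := by
  have hx' := subset_closure hx
  have h1 := E.g_cocycle i i i x ⟨⟨⟨hi, hi⟩, hi⟩, hx'⟩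
  have h2 := (Unitary.mem_iff.1 (E.g_unitary i i x ⟨⟨hi, hi⟩, hx'⟩)).1
  rw [← one_mul (E.g i i x), ← h2, mul_assoc, h1, h2]

theorem star_g {i j : ℕ} {x : R4} (hi : x ∈ E.U i) (hj : x ∈ E.U j) (hx : x ∈ B.carrier) :
    star (E.g i j x) = E.g j i x := by
  have hx' := subset_closure hx
  have h1 := E.g_cocycle i j i x ⟨⟨⟨hi, hj⟩, hi⟩, hx'⟩
  have h2 := (Unitary.mem_iff.1 (E.g_unitary i j x ⟨⟨hi, hj⟩, hx'⟩)).1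
  rw [E.g_self hi hx] at h1
  rw [← mul_one (star (E.g i j x)), ← h1, ← mul_assoc, h2, one_mul]

theorem comp_eq_actE {i j : ℕ} {x : R4} (hi : x ∈ E.U i) (hj : x ∈ E.U j) (hx : x ∈ B.carrier)
    (Φ : R4 → W n) : E.comp j Φ x = actE (E.g j i x) (E.comp i Φ x) := by
  rw [comp, comp, ← mul_actE,
    E.g_cocycle j i _ x ⟨⟨⟨hj, hi⟩, E.mem_U_indexAt hx⟩, subset_closure hx⟩]

theorem comp_indexAt {x : R4} (hx : x ∈ B.carrier) (Φ : R4 → W n) :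
    E.comp (E.indexAt x) Φ x = Φ x := by
  rw [comp, E.g_self (E.mem_U_indexAt hx) hx, one_actE]

theorem inner_comp {i : ℕ} {x : R4} (hi : x ∈ E.U i) (hx : x ∈ B.carrier) (Φ Ψ : R4 → W n) :
    inner ℂ (E.comp i Φ x) (E.comp i Ψ x) = inner ℂ (Φ x) (Ψ x) :=
  inner_actE_actE_of_unitary
    (E.g_unitary _ _ _ ⟨⟨hi, E.mem_U_indexAt hx⟩, subset_closure hx⟩) _ _

theorem comp_injective {i : ℕ} {x : R4} (hi : x ∈ E.U i) (hx : x ∈ B.carrier) {Φ Ψ : R4 → W n}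
    (h : E.comp i Φ x = E.comp i Ψ x) : Φ x = Ψ x := by
  rw [← E.comp_indexAt hx Φ, ← E.comp_indexAt hx Ψ, E.comp_eq_actE hi (E.mem_U_indexAt hx) hx,
    E.comp_eq_actE hi (E.mem_U_indexAt hx) hx Ψ, h]

theorem covDeriv_zero (i : ℕ) (μ : Fin 4) (φ : R4 → W n) (x : R4) :
    E.covDeriv i 0 μ φ x = pd μ φ x + actE (E.A i μ x) (φ x) := by
  simp [covDeriv]

theorem covDeriv_congr (i : ℕ) (z : R4) (μ : Fin 4) {φ ψ : R4 → W n} {x : R4}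
    (h : φ =ᶠ[nhds x] ψ) : E.covDeriv i z μ φ x = E.covDeriv i z μ ψ x := by
  rw [covDeriv, covDeriv, pd_congr h, h.eq_of_nhds]

/-- The compatibility condition `A_compat` absorbs the derivative of the transition function. -/
theorem covDeriv_gauge {i j : ℕ} (μ : Fin 4) {φ : R4 → W n} {x : R4} (hi : x ∈ E.U i)
    (hj : x ∈ E.U j) (hx : x ∈ B.carrier) (hφ : DifferentiableAt ℝ φ x) :
    E.covDeriv j 0 μ (fun y => actE (E.g j i y) (φ y)) x =
      actE (E.g j i x) (E.covDeriv i 0 μ φ x) := by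
  have hg : DifferentiableAt ℝ (E.g j i) x := by
    have ho : IsOpen (E.U j ∩ E.U i ∩ B.carrier) :=
      ((E.isOpen_U j).inter (E.isOpen_U i)).inter B.isOpen
    exact (((E.g_smooth j i).mono (inter_subset_inter_right _ subset_closure)).contDiffAt
      (ho.mem_nhds ⟨⟨hj, hi⟩, hx⟩)).differentiableAt (by simp)
  have h1 : pd μ (fun y => actE (E.g j i y) (φ y)) x =
      actE (E.g j i x) (pd μ φ x) + actE (pd μ (E.g j i) x) (φ x) :=
    pd_bilinear actEL hg hφ μ
  rw [covDeriv_zero, covDeriv_zero, h1, actE_add, ← mul_actE, ← mul_actE,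
    ← E.A_compat j i μ x ⟨⟨hj, hi⟩, hx⟩, add_actE]
  abel

/-! ### Smooth sections with compact support in `B` -/

/-- Smooth sections of `E ⊗ S_±` over `B` with compact support, recorded at each point by their
components in the trivialisation with the smallest index. -/
def sections : Submodule ℂ (R4 → W n) where
  carrier := {Φ | (∃ K, IsCompact K ∧ K ⊆ B.carrier ∧ ∀ x ∉ K, Φ x = 0) ∧
    ∀ i, ContDiffOn ℝ ∞ (E.comp i Φ) (E.U i ∩ B.carrier)}
  zero_mem' := ⟨⟨∅, isCompact_empty, empty_subset _, fun _ _ => rfl⟩, fun i => by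
    refine contDiffOn_const (c := (0 : W n)) |>.congr fun x _ => ?_
    exact actE_zero _⟩
  add_mem' := by
    rintro Φ Ψ ⟨⟨K, hK, hKB, hΦ⟩, hΦs⟩ ⟨⟨L, hL, hLB, hΨ⟩, hΨs⟩
    refine ⟨⟨K ∪ L, hK.union hL, union_subset hKB hLB, fun x hx => ?_⟩, fun i => ?_⟩
    · rw [mem_union, not_or] at hx
      rw [Pi.add_apply, hΦ x hx.1, hΨ x hx.2, add_zero]
    · exact ((hΦs i).add (hΨs i)).congr fun x _ => actE_add _ _ _
  smul_mem' := by
    rintro c Φ ⟨⟨K, hK, hKB, hΦ⟩, hΦs⟩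
    refine ⟨⟨K, hK, hKB, fun x hx => ?_⟩, fun i => ?_⟩
    · rw [Pi.smul_apply, hΦ x hx, smul_zero]
    · exact ((hΦs i).const_smul c).congr fun x _ => actE_smul _ c _

variable {E}

theorem sections_smooth (Φ : E.sections) (i : ℕ) :
    ContDiffOn ℝ ∞ (E.comp i Φ) (E.U i ∩ B.carrier) := Φ.2.2 i

theorem sections_contDiffAt (Φ : E.sections) {i : ℕ} {x : R4} (hi : x ∈ E.U i)
    (hx : x ∈ B.carrier) : ContDiffAt ℝ ∞ (E.comp i Φ) x :=
  (Φ.2.2 i).contDiffAt ((E.isOpen_inter i).mem_nhds ⟨hi, hx⟩)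

theorem sections_differentiableAt (Φ : E.sections) {i : ℕ} {x : R4} (hi : x ∈ E.U i)
    (hx : x ∈ B.carrier) : DifferentiableAt ℝ (E.comp i Φ) x :=
  (sections_contDiffAt Φ hi hx).differentiableAt (by simp)

theorem sections_eq_zero (Φ : E.sections) {x : R4} (hx : x ∉ B.carrier) : (Φ : R4 → W n) x = 0 := by
  obtain ⟨K, -, hKB, h⟩ := Φ.2.1
  exact h x fun h' => hx (hKB h')

theorem sections_ext {Φ Ψ : E.sections}
    (h : ∀ i, ∀ x ∈ E.U i ∩ B.carrier, E.comp i Φ x = E.comp i Ψ x) : Φ = Ψ := by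
  ext1
  funext x
  by_cases hx : x ∈ B.carrier
  · exact E.comp_injective (E.mem_U_indexAt hx) hx (h _ x ⟨E.mem_U_indexAt hx, hx⟩)
  · rw [sections_eq_zero Φ hx, sections_eq_zero Ψ hx]

variable (E)

/-- The covariant derivative of a section. -/
def covFun (μ : Fin 4) (Φ : R4 → W n) : R4 → W n :=
  B.carrier.indicator fun x => E.covDeriv (E.indexAt x) 0 μ (E.comp (E.indexAt x) Φ) x

/-- In `covFun` the index is frozen at the point of differentiation. Gauge covariance shows that
every other trivialisation gives the same section. -/
theorem comp_covFun (μ : Fin 4) (Φ : E.sections) {i : ℕ} {x : R4} (hi : x ∈ E.U i)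
    (hx : x ∈ B.carrier) : E.comp i (E.covFun μ Φ) x = E.covDeriv i 0 μ (E.comp i Φ) x := by
  have hk := E.mem_U_indexAt hx
  rw [comp, covFun, indicator_of_mem hx,
    ← E.covDeriv_gauge μ hk hi hx (sections_differentiableAt Φ hk hx)]
  refine E.covDeriv_congr i 0 μ ?_
  filter_upwards [(E.isOpen_inter i).mem_nhds ⟨hi, hx⟩, (E.isOpen_inter _).mem_nhds ⟨hk, hx⟩]
    with y hy hy'
  exact (E.comp_eq_actE hy'.1 hy.1 hy.2 _).symm

theorem contDiffOn_covDeriv_zero (i : ℕ) (μ : Fin 4) {φ : R4 → W n}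
    (hφ : ContDiffOn ℝ ∞ φ (E.U i ∩ B.carrier)) :
    ContDiffOn ℝ ∞ (E.covDeriv i 0 μ φ) (E.U i ∩ B.carrier) := by
  have hA : ContDiffOn ℝ ∞ (E.A i μ) (E.U i ∩ B.carrier) :=
    (E.A_smooth i μ).mono (inter_subset_inter_right _ subset_closure)
  have h : ContDiffOn ℝ ∞ (fun x => actEL (E.A i μ x) (φ x)) (E.U i ∩ B.carrier) :=
    (actEL.contDiff.comp_contDiffOn hA).clm_apply hφ
  exact ((contDiffOn_pd hφ (E.isOpen_inter i) μ).add h).congr fun x _ => E.covDeriv_zero i μ φ x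

/-- The covariant derivative `∇_μ` on compactly supported sections. -/
def cov (μ : Fin 4) : E.sections →ₗ[ℂ] E.sections where
  toFun Φ := ⟨E.covFun μ Φ, by
    obtain ⟨K, hK, hKB, h⟩ := Φ.2.1
    refine ⟨⟨K, hK, hKB, fun x hx => ?_⟩, fun i => ?_⟩
    · by_cases hB : x ∈ B.carrier
      · have h0 : E.comp (E.indexAt x) Φ =ᶠ[nhds x] fun _ => 0 := by
          filter_upwards [hK.isClosed.isOpen_compl.mem_nhds hx] with y hy
          rw [comp, h y hy, actE_zero]
        rw [covFun, indicator_of_mem hB, E.covDeriv_congr _ 0 μ h0, covDeriv_zero, actE_zero]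
        simp [pd]
      · rw [covFun, indicator_of_notMem hB]
    · exact (E.contDiffOn_covDeriv_zero i μ (sections_smooth Φ i)).congr
        fun x hx => E.comp_covFun μ Φ hx.1 hx.2⟩
  map_add' Φ Ψ := by
    refine sections_ext fun i x hx => ?_
    change E.comp i (E.covFun μ _) x = actE _ (_ + _)
    rw [actE_add]
    change _ = E.comp i (E.covFun μ Φ) x + E.comp i (E.covFun μ Ψ) x
    rw [E.comp_covFun μ _ hx.1 hx.2, E.comp_covFun μ _ hx.1 hx.2, E.comp_covFun μ _ hx.1 hx.2]
    have h : E.comp i (Φ + Ψ : E.sections) = fun y => E.comp i Φ y + E.comp i Ψ y :=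
      funext fun y => actE_add _ _ _
    rw [h, covDeriv_zero, covDeriv_zero, covDeriv_zero, actE_add,
      pd_add (sections_differentiableAt Φ hx.1 hx.2) (sections_differentiableAt Ψ hx.1 hx.2)]
    abel
  map_smul' c Φ := by
    refine sections_ext fun i x hx => ?_
    change E.comp i (E.covFun μ _) x = actE _ (c • _)
    rw [actE_smul]
    change _ = c • E.comp i (E.covFun μ Φ) x
    rw [E.comp_covFun μ _ hx.1 hx.2, E.comp_covFun μ _ hx.1 hx.2]
    have h : E.comp i (c • Φ : E.sections) = fun y => c • E.comp i Φ y :=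
      funext fun y => actE_smul _ _ _
    rw [h, covDeriv_zero, covDeriv_zero, actE_smul, smul_add,
      pd_smul (differentiableAt_const c) (sections_differentiableAt Φ hx.1 hx.2)]
    simp [pd]

theorem comp_cov (μ : Fin 4) (Φ : E.sections) {i : ℕ} {x : R4} (hi : x ∈ E.U i)
    (hx : x ∈ B.carrier) : E.comp i (E.cov μ Φ) x = E.covDeriv i 0 μ (E.comp i Φ) x :=
  E.comp_covFun μ Φ hi hx

/-- The action of a matrix on the spinor factor of sections. -/
def spin (M : Matrix (Fin 2) (Fin 2) ℂ) : E.sections →ₗ[ℂ] E.sections where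
  toFun Φ := ⟨fun x => actS M ((Φ : R4 → W n) x), by
    obtain ⟨K, hK, hKB, h⟩ := Φ.2.1
    refine ⟨⟨K, hK, hKB, fun x hx => ?_⟩, fun i => ?_⟩
    · change actS M _ = 0
      rw [h x hx, ← actSL_apply, map_zero]
    · exact (((actSL M).restrictScalars ℝ).contDiff.comp_contDiffOn (sections_smooth Φ i)).congr
        fun x _ => actE_actS _ _ _⟩
  map_add' Φ Ψ := Subtype.ext (funext fun x => actS_add _ _ _)
  map_smul' c Φ := Subtype.ext (funext fun x => actS_smul _ _ _)

theorem spin_apply (M : Matrix (Fin 2) (Fin 2) ℂ) (Φ : E.sections) (x : R4) :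
    (E.spin M Φ : R4 → W n) x = actS M ((Φ : R4 → W n) x) := rfl

theorem comp_spin (M : Matrix (Fin 2) (Fin 2) ℂ) (Φ : E.sections) (i : ℕ) (x : R4) :
    E.comp i (E.spin M Φ) x = actS M (E.comp i Φ x) := actE_actS _ _ _

theorem contDiff_coord (ν : Fin 4) : ContDiff ℝ ∞ (coord ν) :=
  Complex.ofRealCLM.contDiff.comp (EuclideanSpace.proj (𝕜 := ℝ) ν).contDiff

theorem pd_coord (μ ν : Fin 4) (x : R4) : pd μ (coord ν) x = if μ = ν then 1 else 0 := by
  have h := (Complex.ofRealCLM ∘L EuclideanSpace.proj (𝕜 := ℝ) ν).hasFDerivAt (x := x)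
  have h2 : fderiv ℝ (coord ν) x = Complex.ofRealCLM ∘L EuclideanSpace.proj (𝕜 := ℝ) ν := h.fderiv
  rw [pd, h2]
  by_cases hμ : μ = ν
  · simp [hμ]
  · simp [hμ, Ne.symm hμ]

/-- Multiplication of sections by the coordinate `x_ν`. -/
def mulCoord (ν : Fin 4) : E.sections →ₗ[ℂ] E.sections where
  toFun Φ := ⟨fun x => coord ν x • (Φ : R4 → W n) x, by
    obtain ⟨K, hK, hKB, h⟩ := Φ.2.1
    refine ⟨⟨K, hK, hKB, fun x hx => ?_⟩, fun i => ?_⟩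
    · change coord ν x • _ = 0
      rw [h x hx, smul_zero]
    · exact ((contDiff_coord ν).contDiffOn.smul (sections_smooth Φ i)).congr
        fun x _ => actE_smul _ (coord ν x) _⟩
  map_add' Φ Ψ := Subtype.ext (funext fun x => smul_add _ _ _)
  map_smul' c Φ := Subtype.ext (funext fun x => smul_comm (coord ν x) c ((Φ : R4 → W n) x))

theorem mulCoord_apply (ν : Fin 4) (Φ : E.sections) (x : R4) :
    (E.mulCoord ν Φ : R4 → W n) x = coord ν x • (Φ : R4 → W n) x := rfl

theorem comp_mulCoord (ν : Fin 4) (Φ : E.sections) (i : ℕ) (x : R4) :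
    E.comp i (E.mulCoord ν Φ) x = coord ν x • E.comp i Φ x := by
  rw [comp, mulCoord_apply, actE_smul, comp]

theorem comp_add (i : ℕ) (Φ Ψ : E.sections) (x : R4) :
    E.comp i (Φ + Ψ : E.sections) x = E.comp i Φ x + E.comp i Ψ x := actE_add _ _ _

theorem comp_zero (i : ℕ) (x : R4) : E.comp i (0 : E.sections) x = 0 := actE_zero _

theorem comp_sub (i : ℕ) (Φ Ψ : E.sections) (x : R4) :
    E.comp i (Φ - Ψ : E.sections) x = E.comp i Φ x - E.comp i Ψ x := by
  rw [eq_sub_iff_add_eq, ← comp_add, sub_add_cancel]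

/-! ### Commutation relations -/

theorem cov_spin (μ : Fin 4) (M : Matrix (Fin 2) (Fin 2) ℂ) (Φ : E.sections) :
    E.cov μ (E.spin M Φ) = E.spin M (E.cov μ Φ) := by
  refine sections_ext fun i x hx => ?_
  rw [comp_spin, E.comp_cov _ _ hx.1 hx.2, E.comp_cov _ _ hx.1 hx.2]
  have h : E.comp i (E.spin M Φ) = fun y => (actSL M).restrictScalars ℝ (E.comp i Φ y) :=
    funext fun y => E.comp_spin M Φ i y
  rw [covDeriv_zero, covDeriv_zero, h, pd_clm _ (sections_differentiableAt Φ hx.1 hx.2)]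
  change actS M _ + actE _ (actS M _) = _
  rw [actE_actS, actS_add]

theorem cov_mulCoord (μ ν : Fin 4) (Φ : E.sections) :
    E.cov μ (E.mulCoord ν Φ) = E.mulCoord ν (E.cov μ Φ) + if μ = ν then Φ else 0 := by
  refine sections_ext fun i x hx => ?_
  rw [comp_add, comp_mulCoord, E.comp_cov _ _ hx.1 hx.2, E.comp_cov _ _ hx.1 hx.2]
  have h : E.comp i (E.mulCoord ν Φ) = fun y => coord ν y • E.comp i Φ y :=
    funext fun y => E.comp_mulCoord ν Φ i y
  have hc : DifferentiableAt ℝ (fun y => coord ν y) x :=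
    (contDiff_coord ν).differentiable (by simp) x
  rw [covDeriv_zero, covDeriv_zero, h, pd_smul hc (sections_differentiableAt Φ hx.1 hx.2),
    pd_coord, actE_smul]
  split_ifs with hμ
  · module
  · rw [comp_zero]
    module

theorem spin_mulCoord (ν : Fin 4) (M : Matrix (Fin 2) (Fin 2) ℂ) (Φ : E.sections) :
    E.spin M (E.mulCoord ν Φ) = E.mulCoord ν (E.spin M Φ) := by
  refine sections_ext fun i x _ => ?_
  rw [comp_spin, comp_mulCoord, comp_mulCoord, comp_spin, actS_smul]

theorem spin_spin (M N : Matrix (Fin 2) (Fin 2) ℂ) (Φ : E.sections) :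
    E.spin M (E.spin N Φ) = E.spin (M * N) Φ :=
  Subtype.ext (funext fun _ => (mul_actS M N _).symm)

theorem spin_one (Φ : E.sections) : E.spin 1 Φ = Φ :=
  Subtype.ext (funext fun _ => one_actS _)

theorem smul_spin (c : ℂ) (M : Matrix (Fin 2) (Fin 2) ℂ) (Φ : E.sections) :
    E.spin (c • M) Φ = c • E.spin M Φ :=
  Subtype.ext (funext fun _ => smul_actS c M _)

/-- The second derivatives cancel by symmetry, and the cross terms `A_μ ∂_ν` and `A_ν ∂_μ` occur in
both orders, leaving only zeroth-order terms. -/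
theorem comp_cov_comm (μ ν : Fin 4) (Φ : E.sections) {i : ℕ} {x : R4} (hi : x ∈ E.U i)
    (hx : x ∈ B.carrier) :
    E.comp i (E.cov μ (E.cov ν Φ) - E.cov ν (E.cov μ Φ) : E.sections) x =
      actE (E.curvature i μ ν x) (E.comp i Φ x) := by
  have hA : ∀ κ, DifferentiableAt ℝ (E.A i κ) x := fun κ =>
    (((E.A_smooth i κ).mono (inter_subset_inter_right _ subset_closure)).contDiffAt
      ((E.isOpen_inter i).mem_nhds ⟨hi, hx⟩)).differentiableAt (by simp)
  have hφ := sections_differentiableAt Φ hi hx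
  have key : ∀ κ l, E.comp i (E.cov κ (E.cov l Φ)) x = pd κ (pd l (E.comp i Φ)) x +
      (actE (E.A i l x) (pd κ (E.comp i Φ) x) + actE (pd κ (E.A i l) x) (E.comp i Φ x)) +
      (actE (E.A i κ x) (pd l (E.comp i Φ) x) + actE (E.A i κ x * E.A i l x) (E.comp i Φ x)) := by
    intro κ l
    have h1 : E.comp i (E.cov l Φ) =ᶠ[nhds x]
        fun y => pd l (E.comp i Φ) y + actE (E.A i l y) (E.comp i Φ y) := by
      filter_upwards [(E.isOpen_inter i).mem_nhds ⟨hi, hx⟩] with y hy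
      rw [E.comp_cov _ _ hy.1 hy.2, covDeriv_zero]
    have h2 : DifferentiableAt ℝ (pd l (E.comp i Φ)) x :=
      ((contDiffOn_pd (sections_smooth Φ i) (E.isOpen_inter i) l).contDiffAt
        ((E.isOpen_inter i).mem_nhds ⟨hi, hx⟩)).differentiableAt (by simp)
    have h3 : DifferentiableAt ℝ (fun y => actE (E.A i l y) (E.comp i Φ y)) x :=
      (actEL.hasFDerivAt_of_bilinear (hA l).hasFDerivAt hφ.hasFDerivAt).differentiableAt
    have h4 : pd κ (fun y => actE (E.A i l y) (E.comp i Φ y)) x =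
        actE (E.A i l x) (pd κ (E.comp i Φ) x) + actE (pd κ (E.A i l) x) (E.comp i Φ x) :=
      pd_bilinear actEL (hA l) hφ κ
    rw [E.comp_cov _ _ hi hx, E.covDeriv_congr i 0 κ h1, covDeriv_zero, pd_add h2 h3, h4, actE_add,
      mul_actE]
  rw [comp_sub, key, key, pd_comm (sections_contDiffAt Φ hi hx) μ ν, curvature, add_actE, sub_actE,
    sub_actE]
  abel

theorem cov_comm_of_curvature {μ ν κ l : Fin 4}
    (h : ∀ i, ∀ x ∈ E.U i ∩ B.carrier, E.curvature i μ ν x + E.curvature i κ l x = 0)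
    (Φ : E.sections) :
    (E.cov μ (E.cov ν Φ) - E.cov ν (E.cov μ Φ)) + (E.cov κ (E.cov l Φ) - E.cov l (E.cov κ Φ)) =
      0 := by
  refine sections_ext fun i x hx => ?_
  rw [comp_add, E.comp_cov_comm _ _ _ hx.1 hx.2, E.comp_cov_comm _ _ _ hx.1 hx.2, ← add_actE,
    h i x hx, zero_actE, comp_zero]

end HermitianBundle

end LocalNahm

namespace LocalNahm

namespace HermitianBundle

variable {B : SmoothDomain} {n : ℕ} (E : HermitianBundle B n)

/-! ### Compactly supported sections as elements of `L²` -/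

theorem eventually_eq_zero (Φ : E.sections) {x : R4} (hx : x ∉ B.carrier) :
    ∀ᶠ y in nhds x, (Φ : R4 → W n) y = 0 := by
  obtain ⟨K, hK, hKB, h⟩ := Φ.2.1
  filter_upwards [hK.isClosed.isOpen_compl.mem_nhds fun h' => hx (hKB h')] with y hy
  exact h y hy

theorem eventuallyEq_inner_comp (Φ Ψ : E.sections) {i : ℕ} {x : R4} (hi : x ∈ E.U i)
    (hx : x ∈ B.carrier) :
    (fun y => (inner ℂ ((Φ : R4 → W n) y) ((Ψ : R4 → W n) y) : ℂ)) =ᶠ[nhds x]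
      fun y => inner ℂ (E.comp i Φ y) (E.comp i Ψ y) := by
  filter_upwards [(E.isOpen_inter i).mem_nhds ⟨hi, hx⟩] with y hy
  exact (E.inner_comp hy.1 hy.2 _ _).symm

/-- The recorded functions may jump where the smallest index changes, but the pointwise inner
product is independent of the unitary trivialisation. It vanishes near every point outside `B`,
hence is smooth on the whole space and integration by parts has no boundary term. -/
theorem contDiff_inner_sections (Φ Ψ : E.sections) :
    ContDiff ℝ ∞ fun x => (inner ℂ ((Φ : R4 → W n) x) ((Ψ : R4 → W n) x) : ℂ) := by
  refine contDiff_iff_contDiffAt.2 fun x => ?_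
  by_cases hx : x ∈ B.carrier
  · have hi := E.mem_U_indexAt hx
    exact ((sections_contDiffAt Φ hi hx).inner ℂ (sections_contDiffAt Ψ hi hx)).congr_of_eventuallyEq
      (E.eventuallyEq_inner_comp Φ Ψ hi hx)
  · refine (contDiffAt_const (c := (0 : ℂ))).congr_of_eventuallyEq ?_
    filter_upwards [E.eventually_eq_zero Φ hx] with y hy
    rw [hy, inner_zero_left]

theorem hasCompactSupport_inner_sections (Φ Ψ : E.sections) :
    HasCompactSupport fun x => (inner ℂ ((Φ : R4 → W n) x) ((Ψ : R4 → W n) x) : ℂ) := by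
  obtain ⟨K, hK, -, h⟩ := Φ.2.1
  exact HasCompactSupport.intro hK fun x hx => by rw [h x hx, inner_zero_left]

theorem pd_inner_sections (μ : Fin 4) (Φ Ψ : E.sections) (x : R4) :
    pd μ (fun x => (inner ℂ ((Φ : R4 → W n) x) ((Ψ : R4 → W n) x) : ℂ)) x =
      inner ℂ ((Φ : R4 → W n) x) ((E.cov μ Ψ : R4 → W n) x) +
        inner ℂ ((E.cov μ Φ : R4 → W n) x) ((Ψ : R4 → W n) x) := by
  by_cases hx : x ∈ B.carrier
  · have hi := E.mem_U_indexAt hx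
    rw [pd_congr (E.eventuallyEq_inner_comp Φ Ψ hi hx), ← E.inner_comp hi hx Φ,
      ← E.inner_comp hi hx (E.cov μ Φ), E.comp_cov _ _ hi hx,
      E.comp_cov _ _ hi hx, covDeriv_zero, covDeriv_zero, pd,
      fderiv_inner_apply ℂ (sections_differentiableAt Φ hi hx) (sections_differentiableAt Ψ hi hx),
      inner_add_left, inner_add_right,
      inner_actE_of_skew (E.A_skew _ μ x ⟨hi, subset_closure hx⟩)]
    simp only [pd]
    ring
  · have h : (fun y => (inner ℂ ((Φ : R4 → W n) y) ((Ψ : R4 → W n) y) : ℂ)) =ᶠ[nhds x]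
        fun _ => 0 := by
      filter_upwards [E.eventually_eq_zero Φ hx] with y hy
      rw [hy, inner_zero_left]
    rw [pd_congr h, sections_eq_zero Φ hx, sections_eq_zero Ψ hx, inner_zero_left, inner_zero_right]
    simp [pd]

theorem memLp_sections (Φ : E.sections) : MemLp (Φ : R4 → W n) 2 (volume.restrict B.carrier) := by
  have : IsFiniteMeasure ((volume : Measure R4).restrict B.carrier) :=
    ⟨by rw [Measure.restrict_apply_univ]; exact B.isBounded.measure_lt_top⟩
  obtain ⟨C, hC⟩ := (E.hasCompactSupport_inner_sections Φ Φ).exists_bound_of_continuous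
    (E.contDiff_inner_sections Φ Φ).continuous
  refine MemLp.of_bound (C := Real.sqrt C) ?_ (ae_of_all _ fun x => ?_)
  -- On each piece where the smallest index is `k`, the recorded function is the continuous
  -- component in the trivialisation `k`. The pieces are countably many and measurable.
  · have hB : B.carrier = ⋃ k : ℕ, (E.U k ∩ B.carrier) ∩ (E.indexAt ⁻¹' {k}) := by
      ext x
      simp only [mem_inter_iff, mem_iUnion, mem_preimage, mem_singleton_iff]
      exact ⟨fun h => ⟨_, ⟨E.mem_U_indexAt h, h⟩, rfl⟩, fun ⟨_, h, _⟩ => h.2⟩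
    rw [hB, aestronglyMeasurable_iUnion_iff]
    intro k
    have hms : MeasurableSet ((E.U k ∩ B.carrier) ∩ (E.indexAt ⁻¹' {k})) :=
      (E.isOpen_inter k).measurableSet.inter (E.measurable_indexAt (measurableSet_singleton k))
    refine (((sections_smooth Φ k).continuousOn.mono inter_subset_left).aestronglyMeasurable
      hms).congr ?_
    filter_upwards [ae_restrict_mem hms] with x hx
    have h := E.comp_indexAt hx.1.2 (Φ : R4 → W n)
    rwa [show E.indexAt x = k from hx.2] at h
  · have h := hC x
    rw [inner_self_eq_norm_sq_to_K, norm_pow, RCLike.norm_ofReal, abs_norm] at h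
    exact Real.le_sqrt_of_sq_le h

/-- A compactly supported section as an element of `L²`. -/
def toL2 : E.sections →ₗ[ℂ] E.L2 where
  toFun Φ := (E.memLp_sections Φ).toLp
  map_add' Φ Ψ := MemLp.toLp_add (E.memLp_sections Φ) (E.memLp_sections Ψ)
  map_smul' c Φ := MemLp.toLp_const_smul c (E.memLp_sections Φ)

theorem toL2_ae (Φ : E.sections) : E.toL2 Φ =ᵐ[volume.restrict B.carrier] (Φ : R4 → W n) :=
  (E.memLp_sections Φ).coeFn_toLp

theorem inner_toL2 (Φ Ψ : E.sections) :
    inner ℂ (E.toL2 Φ) (E.toL2 Ψ) = ∫ x, inner ℂ ((Φ : R4 → W n) x) ((Ψ : R4 → W n) x) := by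
  rw [L2.inner_def, ← setIntegral_eq_integral_of_forall_compl_eq_zero (s := B.carrier)
    (f := fun x => (inner ℂ ((Φ : R4 → W n) x) ((Ψ : R4 → W n) x) : ℂ))
    fun x hx => by rw [sections_eq_zero Φ hx, inner_zero_left]]
  refine integral_congr_ae ?_
  filter_upwards [E.toL2_ae Φ, E.toL2_ae Ψ] with x h1 h2
  rw [h1, h2]

/-- Integration by parts. -/
theorem inner_cov (μ : Fin 4) (Φ Ψ : E.sections) :
    inner ℂ (E.toL2 (E.cov μ Φ)) (E.toL2 Ψ) = -inner ℂ (E.toL2 Φ) (E.toL2 (E.cov μ Ψ)) := by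
  have hint : ∀ Φ Ψ : E.sections,
      Integrable fun x => (inner ℂ ((Φ : R4 → W n) x) ((Ψ : R4 → W n) x) : ℂ) := fun Φ Ψ =>
    (E.contDiff_inner_sections Φ Ψ).continuous.integrable_of_hasCompactSupport
      (E.hasCompactSupport_inner_sections Φ Ψ)
  have h := integral_pd_eq_zero ((E.contDiff_inner_sections Φ Ψ).of_le (by simp))
    (E.hasCompactSupport_inner_sections Φ Ψ) μ
  simp only [E.pd_inner_sections] at h
  rw [integral_add (hint Φ (E.cov μ Ψ)) (hint (E.cov μ Φ) Ψ), ← inner_toL2, ← inner_toL2] at h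
  exact eq_neg_of_add_eq_zero_right h

/-! ### Spinor matrices on `L²` -/

/-- The action of a matrix on the spinor factor of `L²(B, E ⊗ S_±)`. -/
def spinOp (M : Matrix (Fin 2) (Fin 2) ℂ) : E.L2 →L[ℂ] E.L2 :=
  (actSL M).compLpL 2 (volume.restrict B.carrier)

theorem spinOp_ae (M : Matrix (Fin 2) (Fin 2) ℂ) (s : E.L2) :
    E.spinOp M s =ᵐ[volume.restrict B.carrier] fun x => actS M (s x) :=
  (actSL M).coeFn_compLpL s

theorem spinOp_toL2 (M : Matrix (Fin 2) (Fin 2) ℂ) (Φ : E.sections) :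
    E.spinOp M (E.toL2 Φ) = E.toL2 (E.spin M Φ) := by
  refine Lp.ext ?_
  filter_upwards [E.spinOp_ae M (E.toL2 Φ), E.toL2_ae Φ, E.toL2_ae (E.spin M Φ)] with x h1 h2 h3
  rw [h1, h2, h3, spin_apply]

theorem inner_spinOp (M : Matrix (Fin 2) (Fin 2) ℂ) (s t : E.L2) :
    inner ℂ (E.spinOp M s) t = inner ℂ s (E.spinOp Mᴴ t) := by
  rw [L2.inner_def, L2.inner_def]
  refine integral_congr_ae ?_
  filter_upwards [E.spinOp_ae M s, E.spinOp_ae Mᴴ t] with x h1 h2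
  rw [h1, h2, inner_actS]

theorem adjoint_spinOp (M : Matrix (Fin 2) (Fin 2) ℂ) :
    ContinuousLinearMap.adjoint (E.spinOp M) = E.spinOp Mᴴ := by
  refine ((ContinuousLinearMap.eq_adjoint_iff _ _).2 fun s t => ?_).symm
  rw [inner_spinOp, Matrix.conjTranspose_conjTranspose]

theorem spinOp_spinOp (M N : Matrix (Fin 2) (Fin 2) ℂ) (s : E.L2) :
    E.spinOp M (E.spinOp N s) = E.spinOp (M * N) s := by
  refine Lp.ext ?_
  filter_upwards [E.spinOp_ae M (E.spinOp N s), E.spinOp_ae N s, E.spinOp_ae (M * N) s]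
    with x h1 h2 h3
  rw [h1, h2, h3, mul_actS]

theorem add_spinOp (M N : Matrix (Fin 2) (Fin 2) ℂ) (s : E.L2) :
    E.spinOp (M + N) s = E.spinOp M s + E.spinOp N s := by
  refine Lp.ext ?_
  filter_upwards [Lp.coeFn_add (E.spinOp M s) (E.spinOp N s), E.spinOp_ae M s, E.spinOp_ae N s,
    E.spinOp_ae (M + N) s] with x h0 h1 h2 h3
  rw [h0, Pi.add_apply, h1, h2, h3, add_actS]

theorem mulOp_coord_toL2 (ν : Fin 4) (Φ : E.sections) :
    E.mulOp (coord ν) (E.toL2 Φ) = E.toL2 (E.mulCoord ν Φ) := by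
  refine Lp.ext ?_
  filter_upwards [E.mulOp_apply_ae (coord ν) (E.toL2 Φ), E.toL2_ae Φ, E.toL2_ae (E.mulCoord ν Φ)]
    with x h1 h2 h3
  rw [h1, h2, h3, mulCoord_apply]

/-! ### The Dirac operator on sections -/

/-- The Dirac operator `D⁺_A` on compactly supported sections. -/
def dirac : E.sections →ₗ[ℂ] E.sections := ∑ μ, E.spin (cliffPlus μ) ∘ₗ E.cov μ

theorem dirac_apply (Φ : E.sections) : E.dirac Φ = ∑ μ, E.spin (cliffPlus μ) (E.cov μ Φ) := by
  simp [dirac]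

theorem dirac_mulCoord (ν : Fin 4) (Φ : E.sections) :
    E.dirac (E.mulCoord ν Φ) = E.mulCoord ν (E.dirac Φ) + E.spin (cliffPlus ν) Φ := by
  simp only [dirac_apply, cov_mulCoord, map_add, spin_mulCoord, map_sum, Finset.sum_add_distrib]
  congr 1
  rw [Finset.sum_eq_single ν] <;> simp +contextual

/-! ### Sections supported in a single trivialisation -/

/-- A test function in the trivialisation `i` as a section recorded in the way of `L2`. -/
def localFun (i : ℕ) (φ : R4 → W n) : R4 → W n :=
  (E.U i ∩ B.carrier).indicator fun x => actE (star (E.g i (E.indexAt x) x)) (φ x)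

theorem comp_localFun {i j : ℕ} {x : R4} (hi : x ∈ E.U i) (hj : x ∈ E.U j) (hx : x ∈ B.carrier)
    (φ : R4 → W n) : E.comp j (E.localFun i φ) x = actE (E.g j i x) (φ x) := by
  have hk := E.mem_U_indexAt hx
  rw [comp, localFun, indicator_of_mem (show x ∈ E.U i ∩ B.carrier from ⟨hi, hx⟩),
    E.star_g hi hk hx, ← mul_actE, E.g_cocycle j _ i x ⟨⟨⟨hj, hk⟩, hi⟩, subset_closure hx⟩]

theorem comp_localFun_self {i : ℕ} {x : R4} (hi : x ∈ E.U i) (hx : x ∈ B.carrier)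
    (φ : R4 → W n) : E.comp i (E.localFun i φ) x = φ x := by
  rw [E.comp_localFun hi hi hx, E.g_self hi hx, one_actE]

theorem localFun_eq_zero_of_notMem (i : ℕ) {φ : R4 → W n} {x : R4} (hx : x ∉ E.U i ∩ B.carrier) :
    E.localFun i φ x = 0 := indicator_of_notMem hx _

theorem localFun_eq_zero (i : ℕ) {φ : R4 → W n} {x : R4} (hx : x ∉ tsupport φ) :
    E.localFun i φ x = 0 := by
  by_cases h : x ∈ E.U i ∩ B.carrier
  · rw [localFun, indicator_of_mem h, image_eq_zero_of_notMem_tsupport hx, actE_zero]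
  · exact E.localFun_eq_zero_of_notMem i h

theorem localFun_mem {i : ℕ} {φ : R4 → W n} (hφ : E.IsTest i φ) : E.localFun i φ ∈ E.sections := by
  refine ⟨⟨tsupport φ, hφ.2.1, hφ.2.2.trans inter_subset_right,
    fun x hx => E.localFun_eq_zero i hx⟩, fun j x hx => ?_⟩
  by_cases hs : x ∈ tsupport φ
  · have hi := hφ.2.2 hs
    have ho : IsOpen (E.U j ∩ E.U i ∩ B.carrier) :=
      ((E.isOpen_U j).inter (E.isOpen_U i)).inter B.isOpen
    have hg : ContDiffAt ℝ ∞ (E.g j i) x :=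
      ((E.g_smooth j i).mono (inter_subset_inter_right _ subset_closure)).contDiffAt
        (ho.mem_nhds ⟨⟨hx.1, hi.1⟩, hx.2⟩)
    have h : ContDiffAt ℝ ∞ (fun y => actEL (E.g j i y) (φ y)) x :=
      (actEL.contDiff.contDiffAt.comp x hg).clm_apply hφ.1.contDiffAt
    refine (h.congr_of_eventuallyEq ?_).contDiffWithinAt
    filter_upwards [ho.mem_nhds ⟨⟨hx.1, hi.1⟩, hx.2⟩] with y hy
    exact E.comp_localFun hy.1.2 hy.1.1 hy.2 φ
  · refine (contDiffAt_const (c := (0 : W n)) |>.congr_of_eventuallyEq ?_).contDiffWithinAt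
    filter_upwards [(isClosed_tsupport φ).isOpen_compl.mem_nhds hs] with y hy
    rw [comp, E.localFun_eq_zero i hy, actE_zero]

/-- A test function in the trivialisation `i` as a section. -/
def localSection {i : ℕ} {φ : R4 → W n} (hφ : E.IsTest i φ) : E.sections :=
  ⟨E.localFun i φ, E.localFun_mem hφ⟩

theorem comp_sum {ι : Type*} (S : Finset ι) (i : ℕ) (Φ : ι → E.sections) (x : R4) :
    E.comp i (∑ k ∈ S, Φ k : E.sections) x = ∑ k ∈ S, E.comp i (Φ k) x := by
  classical
  induction S using Finset.induction_on with
  | empty => exact E.comp_zero i x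
  | insert k S hk ih => rw [Finset.sum_insert hk, Finset.sum_insert hk, comp_add, ih]

theorem comp_dirac (Φ : E.sections) {i : ℕ} {x : R4} (hi : x ∈ E.U i) (hx : x ∈ B.carrier) :
    E.comp i (E.dirac Φ) x = E.diracPlus i 0 (E.comp i Φ) x := by
  rw [dirac_apply, comp_sum, diracPlus]
  exact Finset.sum_congr rfl fun μ _ => by rw [comp_spin, E.comp_cov _ _ hi hx]

theorem diracPlus_congr (i : ℕ) (z : R4) {φ ψ : R4 → W n} {x : R4} (h : φ =ᶠ[nhds x] ψ) :
    E.diracPlus i z φ x = E.diracPlus i z ψ x := by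
  simp only [diracPlus, E.covDeriv_congr i z _ h]

/-- This links the operator on global sections with the functions that test the weak equation in the
definition of `nahmFibre`. -/
theorem toL2_dirac_localSection {i : ℕ} {φ : R4 → W n} (hφ : E.IsTest i φ) :
    E.toL2 (E.dirac (E.localSection hφ)) = (E.memLp_diracRep i 0 hφ).toLp := by
  refine Lp.ext ?_
  filter_upwards [E.toL2_ae (E.dirac (E.localSection hφ)), (E.memLp_diracRep i 0 hφ).coeFn_toLp,
    ae_restrict_mem B.isOpen.measurableSet] with x h1 h2 hx
  rw [h1, h2]
  have hk := E.mem_U_indexAt hx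
  by_cases hi : x ∈ E.U i
  · refine E.comp_injective hi hx ?_
    have h : E.comp i (E.localSection hφ) =ᶠ[nhds x] φ := by
      filter_upwards [(E.isOpen_inter i).mem_nhds ⟨hi, hx⟩] with y hy
      exact E.comp_localFun_self hy.1 hy.2 φ
    rw [E.comp_dirac _ hi hx, E.diracPlus_congr i 0 h]
    exact (E.comp_localFun_self hi hx (E.diracPlus i 0 φ)).symm
  · have hs : x ∉ tsupport φ := fun h => hi (hφ.2.2 h).1
    have h : E.comp (E.indexAt x) (E.localSection hφ) =ᶠ[nhds x] fun _ => 0 := by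
      filter_upwards [(isClosed_tsupport φ).isOpen_compl.mem_nhds hs] with y hy
      exact (congrArg (actE _) (E.localFun_eq_zero i hy)).trans (actE_zero _)
    rw [← E.comp_indexAt hx (E.dirac (E.localSection hφ)), E.comp_dirac _ hk hx,
      E.diracPlus_congr _ 0 h, diracRep,
      indicator_of_notMem (fun h' : x ∈ E.U i ∩ B.carrier => hi h'.1)]
    exact E.diracPlus_eq_zero _ _ (by simp)

/-- The span of the sections supported in a single trivialisation. -/
def localSections : Submodule ℂ E.sections :=
  Submodule.span ℂ {Φ | ∃ (i : ℕ) (φ : R4 → W n) (h : E.IsTest i φ), Φ = E.localSection h}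

/-- A map that preserves the sections supported in a single trivialisation preserves their span. -/
theorem map_mem_localSections (L : E.sections →ₗ[ℂ] E.sections)
    (hL : ∀ i φ (h : E.IsTest i φ), L (E.localSection h) ∈ E.localSections) {Φ : E.sections}
    (hΦ : Φ ∈ E.localSections) : L Φ ∈ E.localSections := by
  have h : E.localSections ≤ E.localSections.comap L := by
    refine Submodule.span_le.2 ?_
    rintro _ ⟨i, φ, h, rfl⟩
    exact hL i φ h
  exact h hΦ

theorem isTest_of_zero_on {i : ℕ} {φ ψ : R4 → W n} (hφ : E.IsTest i φ) (hψ : ContDiff ℝ ∞ ψ)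
    (h : ∀ x, φ x = 0 → ψ x = 0) : E.IsTest i ψ := by
  have hsub : tsupport ψ ⊆ tsupport φ :=
    closure_mono fun x hx h0 => hx (h x h0)
  exact ⟨hψ, hφ.2.1.of_isClosed_subset (isClosed_tsupport ψ) hsub, hsub.trans hφ.2.2⟩

theorem spin_mem_localSections (M : Matrix (Fin 2) (Fin 2) ℂ) {Φ : E.sections}
    (hΦ : Φ ∈ E.localSections) : E.spin M Φ ∈ E.localSections := by
  refine E.map_mem_localSections _ (fun i φ h => ?_) hΦ
  have h2 : E.IsTest i fun x => actS M (φ x) :=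
    E.isTest_of_zero_on h (((actSL M).restrictScalars ℝ).contDiff.comp h.1) fun x hx => by
      rw [hx, ← actSL_apply, map_zero]
  refine Submodule.subset_span ⟨i, _, h2, Subtype.ext (funext fun x => ?_)⟩
  change actS M (E.localFun i φ x) = E.localFun i (fun x => actS M (φ x)) x
  by_cases hx : x ∈ E.U i ∩ B.carrier
  · rw [localFun, localFun, indicator_of_mem hx, indicator_of_mem hx, actE_actS]
  · rw [E.localFun_eq_zero_of_notMem i hx, E.localFun_eq_zero_of_notMem i hx, ← actSL_apply,
      map_zero]

theorem mulCoord_mem_localSections (ν : Fin 4) {Φ : E.sections}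
    (hΦ : Φ ∈ E.localSections) : E.mulCoord ν Φ ∈ E.localSections := by
  refine E.map_mem_localSections _ (fun i φ h => ?_) hΦ
  have h2 : E.IsTest i fun x => coord ν x • φ x :=
    E.isTest_of_zero_on h ((contDiff_coord ν).smul h.1) fun x hx => by rw [hx, smul_zero]
  refine Submodule.subset_span ⟨i, _, h2, Subtype.ext (funext fun x => ?_)⟩
  change coord ν x • E.localFun i φ x = E.localFun i (fun x => coord ν x • φ x) x
  by_cases hx : x ∈ E.U i ∩ B.carrier
  · rw [localFun, localFun, indicator_of_mem hx, indicator_of_mem hx, actE_smul]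
  · rw [E.localFun_eq_zero_of_notMem i hx, E.localFun_eq_zero_of_notMem i hx, smul_zero]

/-- The weak equation is tested only within single trivialisations, so linearity extends it to their
span. Keeping the span as domain avoids partitions of unity. -/
theorem mem_bergmann_iff (s : E.L2) :
    s ∈ E.bergmann ↔ ∀ Φ ∈ E.localSections, inner ℂ (E.toL2 (E.dirac Φ)) s = 0 := by
  constructor
  · intro hs Φ hΦ
    induction hΦ using Submodule.span_induction with
    | mem Φ h =>
      obtain ⟨i, φ, h, rfl⟩ := h
      rw [toL2_dirac_localSection, ← integral_eq_inner]
      · exact hs i φ h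
      · exact h
    | zero => rw [map_zero, map_zero, inner_zero_left]
    | add Φ Ψ _ _ h1 h2 => rw [map_add, map_add, inner_add_left, h1, h2, add_zero]
    | smul c Φ _ h => rw [map_smul, map_smul, inner_smul_left, h, mul_zero]
  · intro h i φ hφ
    rw [E.integral_eq_inner i 0 hφ, ← toL2_dirac_localSection]
    · exact h _ (Submodule.subset_span ⟨i, φ, hφ, rfl⟩)
    · exact hφ

end HermitianBundle

end LocalNahm

namespace LocalNahm

/-! ### Clifford identities -/

theorem cliffMinus_mul_cliffPlus_self (μ : Fin 4) : cliffMinus μ * cliffPlus μ = (-1 : ℂ) • 1 := by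
  have h := cliff_relations_plus μ μ
  rw [if_pos rfl, ← two_smul ℂ] at h
  have h2 := congrArg (fun M => (2⁻¹ : ℂ) • M) h
  simp only [smul_smul] at h2
  norm_num at h2
  rw [h2, neg_one_smul]

theorem cliffMinus_mul_cliffPlus_swap {μ ν : Fin 4} (h : μ ≠ ν) :
    cliffMinus ν * cliffPlus μ = (-1 : ℂ) • (cliffMinus μ * cliffPlus ν) := by
  have h1 := cliff_relations_plus μ ν
  rw [if_neg h] at h1
  rw [neg_one_smul]
  exact eq_neg_of_add_eq_zero_right h1

theorem conjTranspose_cliffPlus (μ : Fin 4) : (cliffPlus μ)ᴴ = (-1 : ℂ) • cliffMinus μ := by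
  rw [cliffPlus, Matrix.conjTranspose_neg, Matrix.conjTranspose_conjTranspose, neg_one_smul]

theorem cliffMinus_mul_conjTranspose (μ : Fin 4) : cliffMinus μ * (cliffMinus μ)ᴴ = 1 := by
  have h := cliffMinus_mul_cliffPlus_self μ
  rw [cliffPlus, mul_neg, neg_one_smul] at h
  exact neg_injective h

theorem conjTranspose_mul_cliffMinus (μ : Fin 4) : (cliffMinus μ)ᴴ * cliffMinus μ = 1 :=
  mul_eq_one_comm.1 (cliffMinus_mul_conjTranspose μ)

/-- Self-dual two-forms act trivially on `S_-`. -/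
theorem cliff_sd_minus :
    (cliffMinus 0)ᴴ * cliffMinus 1 + (cliffMinus 2)ᴴ * cliffMinus 3 =
      (cliffMinus 1)ᴴ * cliffMinus 0 + (cliffMinus 3)ᴴ * cliffMinus 2 ∧
    (cliffMinus 0)ᴴ * cliffMinus 2 + (cliffMinus 3)ᴴ * cliffMinus 1 =
      (cliffMinus 2)ᴴ * cliffMinus 0 + (cliffMinus 1)ᴴ * cliffMinus 3 ∧
    (cliffMinus 0)ᴴ * cliffMinus 3 + (cliffMinus 1)ᴴ * cliffMinus 2 =
      (cliffMinus 3)ᴴ * cliffMinus 0 + (cliffMinus 2)ᴴ * cliffMinus 1 := by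
  refine ⟨?_, ?_, ?_⟩ <;> ext a b <;> simp only [Matrix.add_apply, Matrix.mul_apply,
    Fin.sum_univ_two, Matrix.conjTranspose_apply] <;> fin_cases a <;> fin_cases b <;>
    simp [cliffMinus]

namespace HermitianBundle

variable {B : SmoothDomain} {n : ℕ} (E : HermitianBundle B n)

/-! ### The Weitzenböck formula -/

theorem inner_spin (M : Matrix (Fin 2) (Fin 2) ℂ) (Φ Ψ : E.sections) :
    inner ℂ (E.toL2 (E.spin M Φ)) (E.toL2 Ψ) = inner ℂ (E.toL2 Φ) (E.toL2 (E.spin Mᴴ Ψ)) := by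
  rw [← spinOp_toL2, ← spinOp_toL2, inner_spinOp]

variable {E}

/-- The diagonal terms give `-∑ ∇_μ²`. The off-diagonal ones pair into commutators, that is,
curvature components. On `S_+` the products `c_μ c_ν` coincide for complementary index pairs, so
only the self-dual part of the curvature appears, and it vanishes. -/
theorem weitzenboeck (hE : E.IsASD) (Ψ : E.sections) :
    ∑ μ, ∑ ν, E.spin (cliffMinus μ * cliffPlus ν) (E.cov μ (E.cov ν Ψ)) =
      -∑ μ, E.cov μ (E.cov μ Ψ) := by
  have h1 := congrArg (E.spin (cliffMinus 0 * cliffPlus 1))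
    (E.cov_comm_of_curvature (fun i x hx => (hE i x hx).1) Ψ)
  have h2 := congrArg (E.spin (cliffMinus 0 * cliffPlus 2))
    (E.cov_comm_of_curvature (fun i x hx => (hE i x hx).2.1) Ψ)
  have h3 := congrArg (E.spin (cliffMinus 0 * cliffPlus 3))
    (E.cov_comm_of_curvature (fun i x hx => (hE i x hx).2.2) Ψ)
  simp only [map_add, map_sub, map_zero] at h1 h2 h3
  simp only [Fin.sum_univ_four, cliffMinus_mul_cliffPlus_self]
  rw [cliffMinus_mul_cliffPlus_swap (show (0 : Fin 4) ≠ 1 by decide),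
    cliffMinus_mul_cliffPlus_swap (show (0 : Fin 4) ≠ 2 by decide),
    cliffMinus_mul_cliffPlus_swap (show (0 : Fin 4) ≠ 3 by decide),
    cliffMinus_mul_cliffPlus_swap (show (3 : Fin 4) ≠ 1 by decide),
    cliffMinus_mul_cliffPlus_swap (show (2 : Fin 4) ≠ 3 by decide),
    cliffMinus_mul_cliffPlus_swap (show (1 : Fin 4) ≠ 2 by decide),
    ← cliff_asd_plus.1, ← cliff_asd_plus.2.1, ← cliff_asd_plus.2.2]
  simp only [smul_spin, spin_one]
  linear_combination (norm := module) h1 + h2 + h3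

theorem inner_dirac_dirac (hE : E.IsASD) (Φ Ψ : E.sections) :
    inner ℂ (E.toL2 (E.dirac Φ)) (E.toL2 (E.dirac Ψ)) =
      ∑ μ, inner ℂ (E.toL2 (E.cov μ Φ)) (E.toL2 (E.cov μ Ψ)) := by
  have h1 : ∀ μ, inner ℂ (E.toL2 (E.spin (cliffPlus μ) (E.cov μ Φ))) (E.toL2 (E.dirac Ψ)) =
      inner ℂ (E.toL2 Φ)
        (E.toL2 (∑ ν, E.spin (cliffMinus μ * cliffPlus ν) (E.cov μ (E.cov ν Ψ)))) := by
    intro μ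
    rw [inner_spin, inner_cov, conjTranspose_cliffPlus, smul_spin,
      neg_one_smul ℂ (E.spin (cliffMinus μ) (E.dirac Ψ)), map_neg, map_neg,
      inner_neg_right, neg_neg, cov_spin, dirac_apply, map_sum, map_sum]
    simp only [cov_spin, spin_spin]
  rw [E.dirac_apply Φ, map_sum, sum_inner]
  simp only [h1]
  rw [← inner_sum, ← map_sum, weitzenboeck hE, map_neg, inner_neg_right, map_sum, inner_sum,
    ← Finset.sum_neg_distrib]
  exact Finset.sum_congr rfl fun μ _ => by rw [inner_cov]

theorem norm_sq_dirac (hE : E.IsASD) (Φ : E.sections) :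
    ‖E.toL2 (E.dirac Φ)‖ ^ 2 = ∑ μ, ‖E.toL2 (E.cov μ Φ)‖ ^ 2 := by
  have h := inner_dirac_dirac hE Φ Φ
  simp only [inner_self_eq_norm_sq_to_K] at h
  exact_mod_cast h

/-- By the Weitzenböck formula the form is `∑ ⟨∇_μ Φ, ∇_μ Ψ⟩`, and spinor matrices commute with
`∇_μ`. For the Dirac operator itself this symmetry is not visible. -/
theorem inner_dirac_spin (hE : E.IsASD) (M : Matrix (Fin 2) (Fin 2) ℂ) (Φ Ψ : E.sections) :
    inner ℂ (E.toL2 (E.dirac (E.spin M Φ))) (E.toL2 (E.dirac Ψ)) =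
      inner ℂ (E.toL2 (E.dirac Φ)) (E.toL2 (E.dirac (E.spin Mᴴ Ψ))) := by
  rw [inner_dirac_dirac hE, inner_dirac_dirac hE]
  exact Finset.sum_congr rfl fun μ _ => by rw [cov_spin, cov_spin, inner_spin]

theorem norm_dirac_spin (hE : E.IsASD) {M : Matrix (Fin 2) (Fin 2) ℂ} (hM : Mᴴ * M = 1)
    (Φ : E.sections) : ‖E.toL2 (E.dirac (E.spin M Φ))‖ = ‖E.toL2 (E.dirac Φ)‖ := by
  rw [@norm_eq_sqrt_re_inner ℂ, @norm_eq_sqrt_re_inner ℂ, inner_dirac_spin hE, spin_spin, hM,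
    spin_one]

/-! ### The Poincaré inequality -/

variable (E) in
-- From `[∇_0, x_0] = 1` and integration by parts, `‖Φ‖² = -⟨∇_0 Φ, x_0 Φ⟩ - ⟨Φ, x_0 ∇_0 Φ⟩`. The
-- coordinate `x_0` is a bounded operator because `B` is bounded, and Cauchy–Schwarz on the two
-- terms gives the factor `2`.
theorem norm_toL2_le (Φ : E.sections) :
    ‖E.toL2 Φ‖ ≤ 2 * ‖E.mulOp (coord 0)‖ * ‖E.toL2 (E.cov 0 Φ)‖ := by
  have h1 := E.inner_cov 0 Φ (E.mulCoord 0 Φ)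
  rw [cov_mulCoord, if_pos rfl, map_add, inner_add_right, ← mulOp_coord_toL2,
    ← mulOp_coord_toL2] at h1
  have h2 : (‖E.toL2 Φ‖ ^ 2 : ℂ) =
      -(inner ℂ (E.toL2 (E.cov 0 Φ)) (E.mulOp (coord 0) (E.toL2 Φ)) +
        inner ℂ (E.toL2 Φ) (E.mulOp (coord 0) (E.toL2 (E.cov 0 Φ)))) := by
    have h0 := inner_self_eq_norm_sq_to_K (𝕜 := ℂ) (E.toL2 Φ)
    rw [h1]
    linear_combination -h0
  have hle := fun s : E.L2 => (E.mulOp (coord 0)).le_opNorm s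
  have h3 : ‖E.toL2 Φ‖ ^ 2 ≤
      ‖E.toL2 (E.cov 0 Φ)‖ * (‖E.mulOp (coord 0)‖ * ‖E.toL2 Φ‖) +
        ‖E.toL2 Φ‖ * (‖E.mulOp (coord 0)‖ * ‖E.toL2 (E.cov 0 Φ)‖) := by
    have h4 := congrArg norm h2
    rw [norm_neg, norm_pow, Complex.norm_real, norm_norm] at h4
    rw [h4]
    refine (norm_add_le _ _).trans (add_le_add ?_ ?_)
    · exact (norm_inner_le_norm _ _).trans (mul_le_mul_of_nonneg_left (hle _) (norm_nonneg _))
    · exact (norm_inner_le_norm _ _).trans (mul_le_mul_of_nonneg_left (hle _) (norm_nonneg _))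
  rcases (norm_nonneg (E.toL2 Φ)).eq_or_lt with h | h
  · rw [← h]
    exact mul_nonneg (mul_nonneg zero_le_two (norm_nonneg _)) (norm_nonneg _)
  · refine le_of_mul_le_mul_right ?_ h
    calc ‖E.toL2 Φ‖ * ‖E.toL2 Φ‖ = ‖E.toL2 Φ‖ ^ 2 := (sq _).symm
      _ ≤ _ := h3
      _ = _ := by ring

theorem norm_toL2_le_dirac (hE : E.IsASD) (Φ : E.sections) :
    ‖E.toL2 Φ‖ ≤ 2 * ‖E.mulOp (coord 0)‖ * ‖E.toL2 (E.dirac Φ)‖ := by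
  refine (E.norm_toL2_le Φ).trans ?_
  gcongr
  rw [← sq_le_sq₀ (norm_nonneg _) (norm_nonneg _), norm_sq_dirac hE]
  exact Finset.single_le_sum (f := fun μ => ‖E.toL2 (E.cov μ Φ)‖ ^ 2) (fun _ _ => by positivity)
    (Finset.mem_univ 0)

/-! ### The Green operator and the commutators -/

variable (E) in
/-- The Dirac operator `D⁺_A` as a densely defined operator on `L²`. -/
def localDirac : E.localSections →ₗ[ℂ] E.L2 := E.toL2 ∘ₗ E.dirac ∘ₗ E.localSections.subtype

variable (E) in
/-- The inclusion of the domain of `localDirac` in `L²`. -/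
def localToL2 : E.localSections →ₗ[ℂ] E.L2 := E.toL2 ∘ₗ E.localSections.subtype

variable (E) in
/-- The action of a spinor matrix on the domain of `localDirac`. -/
def localSpin (M : Matrix (Fin 2) (Fin 2) ℂ) : E.localSections →ₗ[ℂ] E.localSections :=
  (E.spin M).restrict fun _ => E.spin_mem_localSections M

variable (E) in
theorem bergmann_eq : E.bergmann = (LinearMap.range E.localDirac)ᗮ := by
  ext s
  rw [mem_bergmann_iff, Submodule.mem_orthogonal]
  constructor
  · rintro h _ ⟨Φ, rfl⟩
    exact h Φ Φ.2
  · intro h Φ hΦ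
    exact h _ ⟨⟨Φ, hΦ⟩, rfl⟩

variable (E) in
/-- The component of `x_ν s` orthogonal to the Bergmann space solves the weak equation
`D⁻_A r = c_ν s`. -/
theorem inner_coord_sub_proj (ν : Fin 4) {s : E.L2} (hs : s ∈ E.bergmann) (Φ : E.localSections) :
    inner ℂ (E.mulOp (coord ν) s - E.bergmann.starProjection (E.mulOp (coord ν) s))
      (E.localDirac Φ) = inner ℂ (E.spinOp (cliffMinus ν) s) (E.localToL2 Φ) := by
  have h0 : ∀ t ∈ E.bergmann, ∀ Ψ ∈ E.localSections, inner ℂ t (E.toL2 (E.dirac Ψ)) = 0 := by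
    intro t ht Ψ hΨ
    rw [inner_eq_zero_symm]
    exact (E.mem_bergmann_iff t).1 ht Ψ hΨ
  have h1 := h0 _ (Submodule.starProjection_apply_mem E.bergmann (E.mulOp (coord ν) s)) Φ Φ.2
  -- Testing `s` against `D⁺(x_ν Φ) = x_ν D⁺Φ + c_ν Φ` trades the coordinate for Clifford
  -- multiplication.
  have h2 := h0 s hs _ (E.mulCoord_mem_localSections ν Φ.2)
  rw [dirac_mulCoord, map_add, inner_add_right, ← mulOp_coord_toL2, ← spinOp_toL2,
    ← inner_mulOp_coord] at h2
  have h3 : inner ℂ (E.spinOp (cliffPlus ν)ᴴ s) (E.toL2 Φ) =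
      inner ℂ s (E.spinOp (cliffPlus ν) (E.toL2 Φ)) := by
    rw [inner_spinOp, Matrix.conjTranspose_conjTranspose]
  have h4 : E.spinOp (cliffPlus ν)ᴴ s = -E.spinOp (cliffMinus ν) s := by
    rw [eq_neg_iff_add_eq_zero, ← add_spinOp, conjTranspose_cliffPlus, neg_one_smul,
      neg_add_cancel]
    refine Lp.ext ?_
    filter_upwards [E.spinOp_ae 0 s, Lp.coeFn_zero (W n) 2 (volume.restrict B.carrier)] with x h h'
    rw [h, h']
    ext a : 1
    simp [actS]
  rw [h4, inner_neg_left] at h3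
  change inner ℂ _ (E.toL2 (E.dirac Φ)) = inner ℂ _ (E.toL2 Φ)
  rw [inner_sub_left, h1, sub_zero, eq_neg_of_add_eq_zero_left h2, ← h3, neg_neg]

variable (E) in
-- The coordinates are self-adjoint and `1 - P_0` is an orthogonal projection, so the part lost by
-- the inner projection can be projected on both sides.
theorem inner_xhat_xhat (μ ν : Fin 4) (s t : E.bergmann) :
    inner ℂ t (E.xhat μ (E.xhat ν s)) =
      inner ℂ (E.mulOp (coord μ) t) (E.mulOp (coord ν) s) -
        inner ℂ (E.mulOp (coord μ) t - E.bergmann.starProjection (E.mulOp (coord μ) t))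
          (E.mulOp (coord ν) s - E.bergmann.starProjection (E.mulOp (coord ν) s)) := by
  have h1 : inner ℂ t (E.xhat μ (E.xhat ν s)) = inner ℂ (E.mulOp (coord μ) t)
      (E.bergmann.starProjection (E.mulOp (coord ν) s)) := by
    have h2 := E.bergmann.inner_starProjection_left_eq_right (t : E.L2)
      (E.mulOp (coord μ) (E.bergmann.starProjection (E.mulOp (coord ν) s)))
    rw [Submodule.starProjection_eq_self_iff.2 t.2, ← inner_mulOp_coord] at h2
    exact h2.symm
  have h3 : inner ℂ (E.bergmann.starProjection (E.mulOp (coord μ) t))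
      (E.mulOp (coord ν) s - E.bergmann.starProjection (E.mulOp (coord ν) s)) = 0 :=
    Submodule.inner_right_of_mem_orthogonal (Submodule.starProjection_apply_mem _ _)
      (Submodule.sub_starProjection_mem_orthogonal _)
  rw [h1, inner_sub_left, h3, sub_zero, inner_sub_right, sub_sub_cancel]

/-- The matrices `c_ν` are unitary, so their action on sections preserves `‖D⁺Φ‖`, and `green_comm`
applies with both constants equal to `1`. -/
theorem spinOp_green_comm (hE : E.IsASD) {K : E.L2 →L[ℂ] E.L2}
    (hK : ∀ Φ, K (E.localDirac Φ) = E.localToL2 Φ)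
    (hK' : ∀ u ∈ (LinearMap.range E.localDirac)ᗮ, K u = 0) (ν : Fin 4) (f : E.L2) :
    K (ContinuousLinearMap.adjoint K (E.spinOp (cliffMinus ν) f)) =
      E.spinOp (cliffMinus ν) (K (ContinuousLinearMap.adjoint K f)) := by
  have h1 : ∀ M Φ, E.localToL2 (E.localSpin M Φ) = E.spinOp M (E.localToL2 Φ) := fun M Φ =>
    (E.spinOp_toL2 M Φ).symm
  have h2 : ∀ M, Mᴴ * M = 1 → ∀ Φ, ‖E.localDirac (E.localSpin M Φ)‖ ≤ 1 * ‖E.localDirac Φ‖ :=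
    fun M hM Φ => by
      rw [one_mul]
      exact (norm_dirac_spin hE hM _).le
  refine green_comm E.localDirac E.localToL2 hK hK' (E.spinOp (cliffMinus ν)) (h1 _)
    (Mt' := E.localSpin (cliffMinus ν)ᴴ) (fun Φ => ?_)
    (h2 _ (conjTranspose_mul_cliffMinus ν)) (h2 _ ?_) (fun Φ Ψ => ?_) f
  · rw [adjoint_spinOp, h1]
  · rw [Matrix.conjTranspose_conjTranspose, cliffMinus_mul_conjTranspose]
  · exact inner_dirac_spin hE _ _ _

variable (E) in
theorem coord_sub_proj_eq_adjoint {K : E.L2 →L[ℂ] E.L2}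
    (hK : ∀ Φ, K (E.localDirac Φ) = E.localToL2 Φ)
    (hK' : ∀ u ∈ (LinearMap.range E.localDirac)ᗮ, K u = 0) (ν : Fin 4) {s : E.L2}
    (hs : s ∈ E.bergmann) :
    E.mulOp (coord ν) s - E.bergmann.starProjection (E.mulOp (coord ν) s) =
      ContinuousLinearMap.adjoint K (E.spinOp (cliffMinus ν) s) := by
  have h : E.mulOp (coord ν) s - E.bergmann.starProjection (E.mulOp (coord ν) s) ∈
      E.bergmannᗮ := Submodule.sub_starProjection_mem_orthogonal _
  exact eq_adjoint_apply_of_range E.localDirac hK hK' (E.bergmann_eq ▸ h)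
    (E.inner_coord_sub_proj ν hs)

theorem exists_localDirac_inverse (hE : E.IsASD) : ∃ K : E.L2 →L[ℂ] E.L2,
    (∀ Φ, K (E.localDirac Φ) = E.localToL2 Φ) ∧
      ∀ u ∈ (LinearMap.range E.localDirac)ᗮ, K u = 0 := by
  have hP : ∀ Φ, ‖E.localToL2 Φ‖ ≤ 2 * ‖E.mulOp (coord 0)‖ * ‖E.localDirac Φ‖ :=
    fun Φ => norm_toL2_le_dirac hE (Φ : E.sections)
  exact exists_clm_extension E.localDirac E.localToL2 hP

/-- If the connection is anti-self-dual, then the products of the operators `x̂_μ` are expressed by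
the Green operator, which commutes with the Clifford operators. -/
theorem exists_green (hE : E.IsASD) : ∃ G : E.L2 →L[ℂ] E.L2, ∀ μ ν, ∀ s t : E.bergmann,
    inner ℂ t (E.xhat μ (E.xhat ν s)) =
      inner ℂ (E.mulOp (coord μ) t) (E.mulOp (coord ν) s) -
        inner ℂ (t : E.L2) (E.spinOp ((cliffMinus μ)ᴴ * cliffMinus ν) (G s)) := by
  obtain ⟨K, hK, hK'⟩ := exists_localDirac_inverse hE
  -- `G = K K*` inverts `D⁻D⁺` weakly. It acts on the `S_+` side, but both half-spinor spaces are
  -- `ℂ²` here, so it may also be applied to `s`.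
  refine ⟨K ∘L ContinuousLinearMap.adjoint K, fun μ ν s t => ?_⟩
  rw [inner_xhat_xhat, E.coord_sub_proj_eq_adjoint hK hK' μ t.2,
    E.coord_sub_proj_eq_adjoint hK hK' ν s.2, ContinuousLinearMap.adjoint_inner_left,
    spinOp_green_comm hE hK hK', inner_spinOp, spinOp_spinOp, ContinuousLinearMap.comp_apply]

/-- In the commutators the terms `⟨x_μ t, x_ν s⟩` cancel because coordinates commute, and the Green
terms cancel by `cliff_sd_minus`. -/
theorem aDHMEquations_of_isASD (hE : E.IsASD) : E.ADHMEquations := by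
  obtain ⟨G, hG⟩ := exists_green hE
  have hx : ∀ μ ν, ∀ s t : E.bergmann, inner ℂ (E.mulOp (coord μ) t) (E.mulOp (coord ν) s) =
      inner ℂ (E.mulOp (coord ν) t) (E.mulOp (coord μ) s) := by
    intro μ ν s t
    rw [inner_mulOp_coord, mulOp_coord_comm, ← inner_mulOp_coord]
  have key : ∀ μ ν κ l, (cliffMinus μ)ᴴ * cliffMinus ν + (cliffMinus κ)ᴴ * cliffMinus l =
      (cliffMinus ν)ᴴ * cliffMinus μ + (cliffMinus l)ᴴ * cliffMinus κ →
      (E.xhat μ * E.xhat ν - E.xhat ν * E.xhat μ) +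
        (E.xhat κ * E.xhat l - E.xhat l * E.xhat κ) = 0 := by
    intro μ ν κ l h
    ext1 s
    refine ext_inner_left ℂ fun t => ?_
    have h1 := congrArg (fun M => inner ℂ (t : E.L2) (E.spinOp M (G s))) h
    simp only [add_spinOp, inner_add_right] at h1
    change inner ℂ t ((E.xhat μ (E.xhat ν s) - E.xhat ν (E.xhat μ s)) +
      (E.xhat κ (E.xhat l s) - E.xhat l (E.xhat κ s))) = inner ℂ t (0 : E.bergmann)
    rw [inner_zero_right, inner_add_right, inner_sub_right, inner_sub_right, hG, hG, hG, hG,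
      hx ν μ, hx l κ]
    linear_combination -h1
  exact ⟨key _ _ _ _ cliff_sd_minus.1, key _ _ _ _ cliff_sd_minus.2.1,
    key _ _ _ _ cliff_sd_minus.2.2⟩

end HermitianBundle

end LocalNahm

end

open LocalNahm LocalNahm.HermitianBundle in
theorem mainTheorem7 (B : SmoothDomain) (n : ℕ) (E : HermitianBundle B n) :
    ContDiff ℝ ∞ E.proj ∧
    (∀ z, E.nahmFibre z = E.bergmann.map (E.mulOp (phase z)).toLinearMap) ∧
    (∀ σ : R4 → E.bergmann, ContDiff ℝ ∞ σ →
      E.IsSmoothSection (fun z => E.mulOp (phase z) (σ z)) ∧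
      ∀ μ z, E.nahmConn μ (fun z => E.mulOp (phase z) (σ z)) z =
        E.mulOp (phase z)
          (pd μ σ z - (2 * Real.pi * Complex.I : ℂ) • E.xhat μ (σ z) : E.bergmann)) ∧
    (E.NahmIsASD ↔ E.ADHMEquations) ∧
    (E.IsASD → E.NahmIsASD ∧ E.ADHMEquations) := by
  exact ⟨E.contDiff_proj, E.nahmFibre_eq_map,
    fun σ hσ => ⟨E.isSmoothSection_mulOp_phase hσ, E.nahmConn_mulOp_phase hσ⟩,
    E.nahmIsASD_iff_aDHMEquations,
    fun h => ⟨E.nahmIsASD_iff_aDHMEquations.2 (aDHMEquations_of_isASD h),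
      aDHMEquations_of_isASD h⟩⟩
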